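/- **Conventions.** All Banach spaces are real, and $\mathbb N=\{1,2,\dots\}$. For finite sets $E,F\subseteq\mathbb N$, $E<F$ means $\max E<\min F$ (or that one of them is empty). Let $(x_i)$ be a linearly independent sequence in a Banach space. A finite or infinite sequence $(y_j)$ is a *block basis* of $(x_i)$, written $(y_j)\prec(x_i)$, if every $y_j$ is a non-zero finite linear combination of the $x_i$ and the supports $\mathrm{supp}(y_j)$ with respect to $(x_i)$ satisfy $\mathrm{supp}(y_1)<\mathrm{supp}(y_2)<\cdots$. The sequence $(x_i)$ is *bimonotone* if for all $m\le n$ the projection $\sum a_ix_i\mapsto\sum_{i=m}^n a_ix_i$ onto an interval of coordinates has norm at most $1$ on finite linear combinations. A Banach space $X$ with a Schauder basis $(u_i)$ is *asymptotic $\ell_1$* if there is $C>0$ such that $\|\sum_{i=1}^n x_i\|\ge\frac1C\sum_{i=1}^n\|x_i\|$ for all $n$ and all finite block bases $(x_i)_{i=1}^n$ of $(u_i)$ with $n\le\min\mathrm{supp}(x_1)$. *Schreier families.* Let $\mathcal S_0=\{\{n\}:n\in\mathbb N\}\cup\{\emptyset\}$ and $\mathcal S_1=\{F:|F|\le\min F\}\cup\{\emptyset\}$.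 For $\alpha<\omega_1$ let $\mathcal S_{\alpha+1}$ be the family of all unions $\bigcup_{i=1}^nG_i$ with $G_i\in\mathcal S_\alpha$ non-empty, $G_1<\dots<G_n$ and $\{\min G_1,\dots,\min G_n\}\in\mathcal S_1$. For a countable limit ordinal $\alpha$ let $\mathcal S_\alpha=\{F: F\in\mathcal S_{\alpha_n}\text{ and } n\le F\text{ for some }n\}$, where $(\alpha_n)$ is a fixed strictly increasing sequence with supremum $\alpha$; these sequences may be chosen arbitrarily. Finite non-empty sets $E_1<\dots<E_k$ are *$\mathcal S_\alpha$-admissible* if $\{\min E_1,\dots,\min E_k\}\in\mathcal S_\alpha$, and $(y_i)_{i=1}^k\prec(x_i)$ is $\mathcal S_\alpha$-admissible if the supports of the $y_i$ with respect to $(x_i)$ are. Let $\delta_\alpha(x_i)$ be the supremum of all $\delta\ge0$ such that $\|\sum_{i=1}^k y_i\|\ge\delta\sum_{i=1}^k\|y_i\|$ for all $\mathcal S_\alpha$-admissible $(y_i)_{i=1}^k\prec(x_i)$. The sequence $(x_i)$ *$\Delta$-stabilizes* $\gamma=(\gamma_\alpha)_{\alpha<\omega_1}\subseteq\mathbb R$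 if there are $\varepsilon_n\downarrow0$ such that for every $\alpha<\omega_1$ there is $m$ with $|\delta_\alpha(y_i)-\gamma_\alpha|<\varepsilon_n$ for all $n\ge m$ and all infinite $(y_i)\prec(x_i)_{i\ge n}$. For $0<\theta<1$ the *Tsirelson space* $T_\theta$ is the completion of the space $c_{00}$ of finitely supported real sequences under the norm determined by $$\|x\|=\max\Bigl(\|x\|_\infty,\ \sup\Bigl\{\theta\sum_{i=1}^k\|E_ix\| : (E_i)_{i=1}^k\text{ is }\mathcal S_1\text{-admissible}\Bigr\}\Bigr),$$ where $E_ix$ is the restriction of $x$ to $E_i$; $(e_i)$ denotes its unit vector basis. **Theorem.** Let $X$ be an asymptotic $\ell_1$ Banach space with respect to its Schauder basis $(u_i)$, and let $(z_i)\prec(u_i)$ be an infinite block basis that $\Delta$-stabilizes some $\gamma=(\gamma_\alpha)_{\alpha<\omega_1}$ with $0<\gamma_1<1$. 1. If $(z_i)$ is normalized and bimonotone, then for every $\varepsilon>0$ there is a subsequence $(x_i)$ of $(z_i)$ such that $$\Bigl\|\sum a_ix_i\Bigr\|\ge(1-\varepsilon)\Bigl\|\sum a_ie_i\Bigr\|_{T_{\gamma_1}}$$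 for all real sequences $(a_i)$ for which $\sum a_ix_i$ converges (in particular for all finitely supported ones); the convergence of $\sum a_ie_i$ in $T_{\gamma_1}$ is part of the claim. 2. Without assuming that $(z_i)$ is normalized or bimonotone: for every $\varepsilon>0$ there is a normalized infinite block basis $(x_i)\prec(z_i)$ such that $$\Bigl\|\sum a_ix_i\Bigr\|\ge\tfrac12(1-\varepsilon)\Bigl\|\sum a_ie_i\Bigr\|_{T_{\gamma_1}}$$ for all real sequences $(a_i)$ for which $\sum a_ix_i$ converges, the convergence of $\sum a_ie_i$ in $T_{\gamma_1}$ again being part of the claim; moreover, for every finite block basis $(y_j)_{j=1}^k\prec(x_i)$, with $m_j=\min\mathrm{supp}(y_j)$ with respect to $(x_i)$, $$\Bigl\|\sum_{j=1}^k y_j\Bigr\|\ge\tfrac12(1-\varepsilon)\Bigl\|\sum_{j=1}^k\|y_j\|\,e_{m_j}\Bigr\|_{T_{\gamma_1}}.$$ -/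

import Mathlib

/-
Conventions. Sequences are indexed by `ℕ = {0, 1, 2, …}`; the index `i` stands for the
`(i+1)`-st term of a sequence `x₁, x₂, …`. Hence a condition `n ≤ min F` on a set `F` of positive
indices reads `∀ k ∈ F, n ≤ k + 1` below.
-/

open Filter Topology

noncomputable section

namespace AsymptoticEllOne

/-! ### Successive and admissible families of finite sets -/

/-- `E₁ < E₂ < ⋯ < Eₙ` (or `E₁ < E₂ < ⋯`) for finite sets of indices. -/
def Successive {ι : Type} [LT ι] (E : ι → Finset ℕ) : Prop :=
  ∀ i j, i < j → ∀ a ∈ E i, ∀ b ∈ E j, a < b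

/-- `E₁ < ⋯ < E_k` is `𝓕`-admissible: the sets are non-empty and successive, and the set of
their minima belongs to `𝓕`. -/
def Admissible (𝓕 : Set (Finset ℕ)) {k : ℕ} (E : Fin k → Finset ℕ) : Prop :=
  Successive E ∧ ∃ m : Fin k → ℕ, (∀ i, IsLeast (E i : Set ℕ) (m i)) ∧ Finset.univ.image m ∈ 𝓕

/-! ### Schreier families -/

/-- The Schreier family `𝓢₁ = {F : |F| ≤ min F} ∪ {∅}`. -/
def schreierOne : Set (Finset ℕ) := {F | ∀ k ∈ F, F.card ≤ k + 1}

/-- `𝓕[𝓖] = {⋃ Gᵢ : G₁ < ⋯ < Gₙ, Gᵢ ∈ 𝓖, (min Gᵢ)ᵢ ∈ 𝓕}`. -/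
def famComp (𝓕 𝓖 : Set (Finset ℕ)) : Set (Finset ℕ) :=
  {F | ∃ (n : ℕ) (G : Fin n → Finset ℕ),
    Admissible 𝓕 G ∧ (∀ i, G i ∈ 𝓖) ∧ F = Finset.univ.biUnion G}

/-- A choice, for every countable limit ordinal `α`, of a sequence `αₙ ↑ α`. -/
def IsLadder (L : Ordinal.{0} → ℕ → Ordinal.{0}) : Prop :=
  ∀ α : Ordinal.{0}, α < Ordinal.omega 1 → Order.IsSuccLimit α →
    StrictMono (L α) ∧ (∀ n, L α n < α) ∧ ∀ β < α, ∃ n, β < L α n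

/-- The Schreier families `𝓢_α` associated with a choice `L` of sequences at limit ordinals:
`𝓢₀` consists of the singletons and `∅`, `𝓢_{α+1} = 𝓢₁[𝓢_α]`, and for limit `α`,
`𝓢_α = {F : F ∈ 𝓢_{αₙ} and n ≤ F for some n}`. Only `α < ω₁` matters. -/
def schreier (L : Ordinal.{0} → ℕ → Ordinal.{0}) (α : Ordinal.{0}) : Set (Finset ℕ) :=
  Ordinal.limitRecOn (motive := fun _ => Set (Finset ℕ)) α
    {F | F = ∅ ∨ ∃ n, F = {n}}
    (fun _ S => famComp schreierOne S)
    (fun β _ S => {F | ∃ (n : ℕ) (h : L β n < β), F ∈ S (L β n) h ∧ ∀ k ∈ F, n + 1 ≤ k + 1})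

theorem schreier_zero (L : Ordinal.{0} → ℕ → Ordinal.{0}) :
    schreier L 0 = {F | F = ∅ ∨ ∃ n, F = {n}} := by
  simp [schreier, Ordinal.limitRecOn_zero]

theorem schreier_add_one (L : Ordinal.{0} → ℕ → Ordinal.{0}) (α : Ordinal.{0}) :
    schreier L (α + 1) = famComp schreierOne (schreier L α) := by
  simp [schreier, Ordinal.limitRecOn_add_one]

theorem schreier_limit (L : Ordinal.{0} → ℕ → Ordinal.{0}) (hL : IsLadder L) (α : Ordinal.{0})
    (hα : α < Ordinal.omega 1) (hlim : Order.IsSuccLimit α) :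
    schreier L α = {F | ∃ n, F ∈ schreier L (L α n) ∧ ∀ k ∈ F, n + 1 ≤ k + 1} := by
  have h := (hL α hα hlim).2.1
  unfold schreier
  rw [Ordinal.limitRecOn_limit _ _ _ _ hlim]
  ext F
  constructor
  · rintro ⟨n, _, h1, h2⟩
    exact ⟨n, h1, h2⟩
  · rintro ⟨n, h1, h2⟩
    exact ⟨n, h n, h1, h2⟩

/-! ### Block bases and asymptotic constants -/

section Blocks

variable {X : Type*} [NormedAddCommGroup X] [NormedSpace ℝ X]

/-- The vector `∑ aᵢ xᵢ` with finitely supported coefficients. -/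
def lin (x : ℕ → X) (a : ℕ →₀ ℝ) : X := a.sum fun i r => r • x i

/-- Coefficient vectors of non-zero successive blocks. -/
def IsBlockCoeffs {ι : Type} [LT ι] (c : ι → ℕ →₀ ℝ) : Prop :=
  (∀ i, c i ≠ 0) ∧ Successive fun i => (c i).support

/-- `(xᵢ) ≺ (eᵢ)`: `x` is an (infinite) block basis of `e`. -/
def IsBlockBasis (e x : ℕ → X) : Prop :=
  ∃ c : ℕ → ℕ →₀ ℝ, IsBlockCoeffs c ∧ ∀ i, x i = lin e (c i)

/-- The space `X` with the Schauder basis `e` is asymptotic `ℓ₁`: there is `C > 0` such that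
`‖∑ xᵢ‖ ≥ (1/C) ∑ ‖xᵢ‖` for all `n` and all `eₙ ≤ x₁ < ⋯ < xₙ`. -/
def IsAsymptoticEllOne (e : SchauderBasis ℝ X) : Prop :=
  ∃ C : ℝ, 0 < C ∧ ∀ (n : ℕ) (c : Fin n → ℕ →₀ ℝ), IsBlockCoeffs c →
    (∀ i, ∀ k ∈ (c i).support, n ≤ k + 1) →
    (1 / C) * ∑ i, ‖lin e.basis (c i)‖ ≤ ‖∑ i, lin e.basis (c i)‖

/-- `δ_𝓕(xᵢ)`: the supremum of all `δ ≥ 0` such that `‖∑ yᵢ‖ ≥ δ ∑ ‖yᵢ‖` for all finite block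
sequences `(yᵢ)` of `(xᵢ)` that are `𝓕`-admissible with respect to `(xᵢ)`. -/
def deltaConst (𝓕 : Set (Finset ℕ)) (x : ℕ → X) : ℝ :=
  sSup {δ : ℝ | 0 ≤ δ ∧ ∀ (k : ℕ) (c : Fin k → ℕ →₀ ℝ), IsBlockCoeffs c →
    Admissible 𝓕 (fun i => (c i).support) →
    δ * ∑ i, ‖lin x (c i)‖ ≤ ‖∑ i, lin x (c i)‖}

/-- `(xᵢ)` `Δ`-stabilizes `γ = (γ_α)_{α < ω₁}`: there are `εₙ ↓ 0` such that for every `α < ω₁`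
there is `m` with `|δ_α(y) - γ_α| < εₙ` for all `n ≥ m` and all block bases `y` of the tail
of `x` that starts at `n`. -/
def DeltaStabilizes (L : Ordinal.{0} → ℕ → Ordinal.{0}) (x : ℕ → X) (γ : Ordinal.{0} → ℝ) :
    Prop :=
  ∃ ε : ℕ → ℝ, Antitone ε ∧ Tendsto ε atTop (𝓝 0) ∧
    ∀ α : Ordinal.{0}, α < Ordinal.omega 1 → ∃ m : ℕ, ∀ n ≥ m, ∀ y : ℕ → X,
      IsBlockBasis (fun i => x (n + i)) y → |deltaConst (schreier L α) y - γ α| < ε n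

/-- `(xᵢ)` is bimonotone: the projections onto intervals of coordinates have norm at most one. -/
def IsBimonotone (x : ℕ → X) : Prop :=
  ∀ (a : ℕ →₀ ℝ) (m n : ℕ), ‖∑ i ∈ Finset.Ico m n, a i • x i‖ ≤ ‖lin x a‖

end Blocks

/-! ### The Tsirelson space `T_θ` -/

/-- The restriction `E x` of a finitely supported sequence `x` to the set `E`. -/
def restr (E : Finset ℕ) (x : ℕ →₀ ℝ) : ℕ →₀ ℝ := x.filter (· ∈ E)

/-- The numbers `θ ∑ᵢ N(Eᵢ x)` over all `𝓢₁`-admissible `E₁ < ⋯ < E_k`. -/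
def admissibleSums (θ : ℝ) (N : (ℕ →₀ ℝ) → ℝ) (x : ℕ →₀ ℝ) : Set ℝ :=
  {r | ∃ (k : ℕ) (E : Fin k → Finset ℕ), Admissible schreierOne E ∧ r = θ * ∑ i, N (restr (E i) x)}

/-- The iterates `‖·‖₀ = ‖·‖_∞` and
`‖x‖_{m+1} = max (‖x‖_m, sup {θ ∑ ‖Eᵢ x‖_m : (Eᵢ) is 𝓢₁-admissible})`. -/
def tsirelsonIter (θ : ℝ) : ℕ → (ℕ →₀ ℝ) → ℝ
  | 0, x => ⨆ i, |x i|
  | m + 1, x => max (tsirelsonIter θ m x) (sSup (admissibleSums θ (tsirelsonIter θ m) x))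

/-- The Tsirelson norm on `c₀₀`, the limit (supremum) of the iterates. It satisfies the implicit
equation, see `tsirelsonNorm_eq`. -/
def tsirelsonNorm (θ : ℝ) (x : ℕ →₀ ℝ) : ℝ := ⨆ m, tsirelsonIter θ m x

/-- The `ℓ₁` norm on `c₀₀`, an upper bound for the Tsirelson norm. -/
def ellOne (x : ℕ →₀ ℝ) : ℝ := ∑ i ∈ x.support, |x i|

theorem ellOne_eq (x : ℕ →₀ ℝ) {S : Finset ℕ} (h : x.support ⊆ S) : ellOne x = ∑ i ∈ S, |x i| :=
  Finset.sum_subset h fun i _ hi => by simpa using hi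

theorem bdd_abs (x : ℕ →₀ ℝ) : BddAbove (Set.range fun i => |x i|) := by
  refine ⟨ellOne x, ?_⟩
  rintro _ ⟨i, rfl⟩
  by_cases h : i ∈ x.support
  · exact Finset.single_le_sum (f := fun i => |x i|) (fun _ _ => abs_nonneg _) h
  · have : x i = 0 := by simpa using h
    simpa [this, ellOne] using Finset.sum_nonneg fun i _ => abs_nonneg (x i)

theorem sum_ellOne_restr_le {k : ℕ} (E : Fin k → Finset ℕ) (hE : Successive E) (x : ℕ →₀ ℝ) :
    ∑ i, ellOne (restr (E i) x) ≤ ellOne x := by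
  have h1 : ∀ i, ellOne (restr (E i) x) = ∑ j ∈ x.support.filter (· ∈ E i), |x j| := by
    intro i
    rw [ellOne, restr, Finsupp.support_filter]
    exact Finset.sum_congr rfl fun j hj => by
      rw [Finsupp.filter_apply_pos _ _ (Finset.mem_filter.1 hj).2]
  simp_rw [h1]
  rw [← Finset.sum_biUnion]
  · exact Finset.sum_le_sum_of_subset_of_nonneg
      (Finset.biUnion_subset.2 fun i _ => Finset.filter_subset _ _) fun _ _ _ => abs_nonneg _
  · intro i _ j _ hij
    refine Finset.disjoint_left.2 fun a ha hb => ?_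
    have ha := (Finset.mem_filter.1 ha).2
    have hb := (Finset.mem_filter.1 hb).2
    rcases lt_or_gt_of_ne hij with h | h
    · exact lt_irrefl _ (hE i j h a ha a hb)
    · exact lt_irrefl _ (hE j i h a hb a ha)

section TsirelsonNorm

variable {θ : ℝ}

theorem iter_bounds (h1 : θ ≤ 1) (m : ℕ) (x : ℕ →₀ ℝ) :
    0 ≤ tsirelsonIter θ m x ∧ tsirelsonIter θ m x ≤ ellOne x := by
  induction m generalizing x with
  | zero =>
    refine ⟨Real.iSup_nonneg fun i => abs_nonneg _, ciSup_le fun i => ?_⟩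
    by_cases h : i ∈ x.support
    · exact Finset.single_le_sum (f := fun i => |x i|) (fun _ _ => abs_nonneg _) h
    · have : x i = 0 := by simpa using h
      simpa [this, ellOne] using Finset.sum_nonneg fun i _ => abs_nonneg (x i)
  | succ m ih =>
    refine ⟨le_max_of_le_left (ih x).1, max_le (ih x).2 (Real.sSup_le ?_ ?_)⟩
    · rintro r ⟨k, E, hE, rfl⟩
      calc θ * ∑ i, tsirelsonIter θ m (restr (E i) x)
          ≤ 1 * ∑ i, tsirelsonIter θ m (restr (E i) x) :=
            mul_le_mul_of_nonneg_right h1 (Finset.sum_nonneg fun i _ => (ih _).1)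
        _ ≤ ∑ i, ellOne (restr (E i) x) := by
            rw [one_mul]; exact Finset.sum_le_sum fun i _ => (ih _).2
        _ ≤ ellOne x := sum_ellOne_restr_le E hE.1 x
    · exact Finset.sum_nonneg fun i _ => abs_nonneg _

theorem bdd_admissibleSums (h1 : θ ≤ 1) (N : (ℕ →₀ ℝ) → ℝ)
    (hN : ∀ x, 0 ≤ N x ∧ N x ≤ ellOne x) (x : ℕ →₀ ℝ) : BddAbove (admissibleSums θ N x) := by
  refine ⟨ellOne x, ?_⟩
  rintro r ⟨k, E, hE, rfl⟩
  calc θ * ∑ i, N (restr (E i) x)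
      ≤ 1 * ∑ i, N (restr (E i) x) :=
        mul_le_mul_of_nonneg_right h1 (Finset.sum_nonneg fun i _ => (hN _).1)
    _ ≤ ∑ i, ellOne (restr (E i) x) := by
        rw [one_mul]; exact Finset.sum_le_sum fun i _ => (hN _).2
    _ ≤ ellOne x := sum_ellOne_restr_le E hE.1 x

theorem bdd_iter (h1 : θ ≤ 1) (x : ℕ →₀ ℝ) :
    BddAbove (Set.range fun m => tsirelsonIter θ m x) :=
  ⟨ellOne x, by rintro _ ⟨m, rfl⟩; exact (iter_bounds h1 m x).2⟩

theorem iter_le_norm (h1 : θ ≤ 1) (m : ℕ) (x : ℕ →₀ ℝ) :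
    tsirelsonIter θ m x ≤ tsirelsonNorm θ x :=
  le_ciSup (bdd_iter h1 x) m

theorem iter_mono (x : ℕ →₀ ℝ) : Monotone fun m => tsirelsonIter θ m x :=
  monotone_nat_of_le_succ fun _ => le_max_left _ _

theorem norm_bounds (h1 : θ ≤ 1) (x : ℕ →₀ ℝ) :
    0 ≤ tsirelsonNorm θ x ∧ tsirelsonNorm θ x ≤ ellOne x :=
  ⟨(iter_bounds h1 0 x).1.trans (iter_le_norm h1 0 x),
    ciSup_le fun m => (iter_bounds h1 m x).2⟩

/-- The implicit equation of the Tsirelson norm: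
`‖x‖ = max (‖x‖_∞, sup {θ ∑ ‖Eᵢ x‖ : (Eᵢ) is 𝓢₁-admissible})`, a supremum of a bounded set. -/
theorem tsirelsonNorm_eq (h0 : 0 ≤ θ) (h1 : θ ≤ 1) (x : ℕ →₀ ℝ) :
    BddAbove (admissibleSums θ (tsirelsonNorm θ) x) ∧
      tsirelsonNorm θ x = max (⨆ i, |x i|) (sSup (admissibleSums θ (tsirelsonNorm θ) x)) := by
  have hb := bdd_admissibleSums h1 _ (norm_bounds h1) x
  refine ⟨hb, le_antisymm (ciSup_le fun m => ?_)
    (max_le (iter_le_norm h1 0 x) (Real.sSup_le ?_ (norm_bounds h1 x).1))⟩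
  · induction m with
    | zero => exact le_max_left _ _
    | succ m ih =>
      refine max_le ih (le_max_of_le_right (Real.sSup_le ?_ ?_))
      · rintro r ⟨k, E, hE, rfl⟩
        refine le_trans ?_ (le_csSup hb ⟨k, E, hE, rfl⟩)
        exact mul_le_mul_of_nonneg_left
          (Finset.sum_le_sum fun i _ => iter_le_norm h1 m _) h0
      · refine Real.sSup_nonneg ?_
        rintro r ⟨k, E, hE, rfl⟩
        exact mul_nonneg h0 (Finset.sum_nonneg fun i _ => (norm_bounds h1 _).1)
  · rintro r ⟨k, E, hE, rfl⟩
    have ht : Tendsto (fun m => θ * ∑ i, tsirelsonIter θ m (restr (E i) x)) atTop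
        (𝓝 (θ * ∑ i, tsirelsonNorm θ (restr (E i) x))) :=
      (tendsto_finsetSum _ fun i _ =>
        tendsto_atTop_ciSup (iter_mono _) (bdd_iter h1 _)).const_mul θ
    refine le_of_tendsto' ht fun m => le_trans ?_ (iter_le_norm h1 (m + 1) x)
    exact le_max_of_le_right
      (le_csSup (bdd_admissibleSums h1 _ (iter_bounds h1 m) x) ⟨k, E, hE, rfl⟩)

theorem restr_add (E : Finset ℕ) (x y : ℕ →₀ ℝ) : restr E (x + y) = restr E x + restr E y :=
  Finsupp.filter_add

theorem restr_smul (E : Finset ℕ) (r : ℝ) (x : ℕ →₀ ℝ) : restr E (r • x) = r • restr E x :=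
  Finsupp.filter_smul

theorem iter_add_le (h0 : 0 ≤ θ) (h1 : θ ≤ 1) (m : ℕ) (x y : ℕ →₀ ℝ) :
    tsirelsonIter θ m (x + y) ≤ tsirelsonIter θ m x + tsirelsonIter θ m y := by
  induction m generalizing x y with
  | zero =>
    refine ciSup_le fun i => (abs_add_le (x i) (y i)).trans ?_
    exact add_le_add (le_ciSup (bdd_abs x) i) (le_ciSup (bdd_abs y) i)
  | succ m ih =>
    refine max_le ((ih x y).trans (add_le_add (le_max_left _ _) (le_max_left _ _)))
      (Real.sSup_le ?_ (add_nonneg (iter_bounds h1 (m + 1) x).1 (iter_bounds h1 (m + 1) y).1))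
    rintro r ⟨k, E, hE, rfl⟩
    have hle : ∀ z : ℕ →₀ ℝ, θ * ∑ i, tsirelsonIter θ m (restr (E i) z) ≤
        tsirelsonIter θ (m + 1) z := fun z => le_max_of_le_right
      (le_csSup (bdd_admissibleSums h1 _ (iter_bounds h1 m) z) ⟨k, E, hE, rfl⟩)
    refine le_trans ?_ (add_le_add (hle x) (hle y))
    rw [← mul_add, ← Finset.sum_add_distrib]
    refine mul_le_mul_of_nonneg_left (Finset.sum_le_sum fun i _ => ?_) h0
    rw [restr_add]
    exact ih _ _

theorem iter_smul_le (h0 : 0 ≤ θ) (h1 : θ ≤ 1) (m : ℕ) (r : ℝ) (x : ℕ →₀ ℝ) :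
    tsirelsonIter θ m (r • x) ≤ |r| * tsirelsonIter θ m x := by
  induction m generalizing x with
  | zero =>
    refine ciSup_le fun i => ?_
    rw [Finsupp.smul_apply, smul_eq_mul, abs_mul]
    exact mul_le_mul_of_nonneg_left (le_ciSup (bdd_abs x) i) (abs_nonneg r)
  | succ m ih =>
    refine max_le ((ih x).trans (mul_le_mul_of_nonneg_left (le_max_left _ _) (abs_nonneg r)))
      (Real.sSup_le ?_ (mul_nonneg (abs_nonneg r) (iter_bounds h1 (m + 1) x).1))
    rintro _ ⟨k, E, hE, rfl⟩
    have hle : θ * ∑ i, tsirelsonIter θ m (restr (E i) x) ≤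
        tsirelsonIter θ (m + 1) x := le_max_of_le_right
      (le_csSup (bdd_admissibleSums h1 _ (iter_bounds h1 m) x) ⟨k, E, hE, rfl⟩)
    refine le_trans ?_ (mul_le_mul_of_nonneg_left hle (abs_nonneg r))
    rw [mul_left_comm, Finset.mul_sum (a := |r|)]
    refine mul_le_mul_of_nonneg_left (Finset.sum_le_sum fun i _ => ?_) h0
    rw [restr_smul]
    exact ih _

theorem norm_add_le' (h0 : 0 ≤ θ) (h1 : θ ≤ 1) (x y : ℕ →₀ ℝ) :
    tsirelsonNorm θ (x + y) ≤ tsirelsonNorm θ x + tsirelsonNorm θ y :=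
  ciSup_le fun m => (iter_add_le h0 h1 m x y).trans
    (add_le_add (iter_le_norm h1 m x) (iter_le_norm h1 m y))

theorem norm_smul_le' (h0 : 0 ≤ θ) (h1 : θ ≤ 1) (r : ℝ) (x : ℕ →₀ ℝ) :
    tsirelsonNorm θ (r • x) ≤ |r| * tsirelsonNorm θ x :=
  ciSup_le fun m => (iter_smul_le h0 h1 m r x).trans
    (mul_le_mul_of_nonneg_left (iter_le_norm h1 m x) (abs_nonneg r))

theorem norm_smul_eq (h0 : 0 ≤ θ) (h1 : θ ≤ 1) (r : ℝ) (x : ℕ →₀ ℝ) :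
    tsirelsonNorm θ (r • x) = |r| * tsirelsonNorm θ x := by
  refine le_antisymm (norm_smul_le' h0 h1 r x) ?_
  by_cases hr : r = 0
  · simpa [hr] using (norm_bounds h1 0).1
  · have h := norm_smul_le' h0 h1 r⁻¹ (r • x)
    rw [smul_smul, inv_mul_cancel₀ hr, one_smul, abs_inv] at h
    rwa [← le_inv_mul_iff₀ (abs_pos.2 hr)]

theorem norm_eq_zero_iff' (h1 : θ ≤ 1) (x : ℕ →₀ ℝ) :
    tsirelsonNorm θ x = 0 ↔ x = 0 := by
  constructor
  · intro h
    ext i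
    have : |x i| ≤ 0 := (le_ciSup (bdd_abs x) i).trans ((iter_le_norm h1 0 x).trans h.le)
    simpa using this
  · rintro rfl
    exact le_antisymm (by simpa [ellOne] using (norm_bounds h1 0).2) (norm_bounds h1 0).1

end TsirelsonNorm

/-- The space `c₀₀` of finitely supported sequences, to be given the norm of `T_θ`. -/
def TsirelsonC00 (_θ : Set.Ioo (0 : ℝ) 1) : Type := ℕ →₀ ℝ

instance (θ : Set.Ioo (0 : ℝ) 1) : AddCommGroup (TsirelsonC00 θ) :=
  inferInstanceAs (AddCommGroup (ℕ →₀ ℝ))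

instance (θ : Set.Ioo (0 : ℝ) 1) : Module ℝ (TsirelsonC00 θ) :=
  inferInstanceAs (Module ℝ (ℕ →₀ ℝ))

instance (θ : Set.Ioo (0 : ℝ) 1) : Norm (TsirelsonC00 θ) := ⟨fun x => tsirelsonNorm θ x⟩

theorem tsirelsonCore (θ : Set.Ioo (0 : ℝ) 1) : NormedSpace.Core ℝ (TsirelsonC00 θ) where
  norm_nonneg x := (norm_bounds θ.2.2.le x).1
  norm_smul r x := norm_smul_eq θ.2.1.le θ.2.2.le r x
  norm_triangle x y := norm_add_le' θ.2.1.le θ.2.2.le x y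
  norm_eq_zero_iff x := norm_eq_zero_iff' θ.2.2.le x

instance (θ : Set.Ioo (0 : ℝ) 1) : NormedAddCommGroup (TsirelsonC00 θ) :=
  NormedAddCommGroup.ofCore (tsirelsonCore θ)

instance (θ : Set.Ioo (0 : ℝ) 1) : NormedSpace ℝ (TsirelsonC00 θ) :=
  NormedSpace.ofCore (tsirelsonCore θ)

/-- The Tsirelson space `T_θ = T(𝓢₁, θ)`, the completion of `c₀₀` in the Tsirelson norm. -/
abbrev TsirelsonSpace (θ : Set.Ioo (0 : ℝ) 1) : Type := UniformSpace.Completion (TsirelsonC00 θ)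

/-- A finitely supported sequence as an element of `T_θ`. -/
def toTsirelson (θ : Set.Ioo (0 : ℝ) 1) (a : ℕ →₀ ℝ) : TsirelsonSpace θ :=
  ((show TsirelsonC00 θ from a) : UniformSpace.Completion (TsirelsonC00 θ))

/-- The unit vector basis of `T_θ`. -/
def tsirelsonUnit (θ : Set.Ioo (0 : ℝ) 1) (i : ℕ) : TsirelsonSpace θ :=
  toTsirelson θ (Finsupp.single i 1)

theorem norm_toTsirelson (θ : Set.Ioo (0 : ℝ) 1) (a : ℕ →₀ ℝ) :
    ‖toTsirelson θ a‖ = tsirelsonNorm θ a :=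
  UniformSpace.Completion.norm_coe (E := TsirelsonC00 θ) a

/-- `∑ aᵢ eᵢ` in `T_θ` is the finitely supported sequence `a`. -/
theorem lin_tsirelsonUnit (θ : Set.Ioo (0 : ℝ) 1) (a : ℕ →₀ ℝ) :
    lin (tsirelsonUnit θ) a = toTsirelson θ a := by
  let φ : (ℕ →₀ ℝ) →ₗ[ℝ] TsirelsonSpace θ :=
    { toFun := toTsirelson θ
      map_add' := fun x y => UniformSpace.Completion.coe_add (α := TsirelsonC00 θ) x y
      map_smul' := fun r x => UniformSpace.Completion.coe_smul (X := TsirelsonC00 θ) r x }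
  have h : φ a = φ (a.sum Finsupp.single) := by rw [Finsupp.sum_single]
  change _ = φ a
  rw [h, Finsupp.sum, map_sum, lin, Finsupp.sum]
  refine Finset.sum_congr rfl fun i _ => ?_
  change a i • φ (Finsupp.single i 1) = _
  rw [← map_smul, Finsupp.smul_single, smul_eq_mul, mul_one]

/-! ### Lower Tsirelson estimates -/

section Estimates

variable {X : Type*} [NormedAddCommGroup X] [NormedSpace ℝ X]

/-- `‖∑ aᵢ xᵢ‖ ≥ C ‖∑ aᵢ eᵢ‖` in `T_θ`, for all finitely supported scalar sequences `a`, and for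
all scalar sequences `a` for which `∑ aᵢ xᵢ` converges, the convergence of `∑ aᵢ eᵢ` in `T_θ`
being part of the claim. -/
def LowerEstimate (θ : Set.Ioo (0 : ℝ) 1) (C : ℝ) (x : ℕ → X) : Prop :=
  (∀ a : ℕ →₀ ℝ, C * ‖lin (tsirelsonUnit θ) a‖ ≤ ‖lin x a‖) ∧
  ∀ (a : ℕ → ℝ) (v : X), Tendsto (fun n => ∑ i ∈ Finset.range n, a i • x i) atTop (𝓝 v) →
    ∃ t : TsirelsonSpace θ,
      Tendsto (fun n => ∑ i ∈ Finset.range n, a i • tsirelsonUnit θ i) atTop (𝓝 t) ∧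
      C * ‖t‖ ≤ ‖v‖

/-- `‖∑ yⱼ‖ ≥ C ‖∑ ‖yⱼ‖ e_{mⱼ}‖` in `T_θ`, for all finite block sequences `(yⱼ)` of `(xᵢ)`,
where `mⱼ` is the minimum of the support of `yⱼ` with respect to `(xᵢ)`. -/
def LowerBlockEstimate (θ : Set.Ioo (0 : ℝ) 1) (C : ℝ) (x : ℕ → X) : Prop :=
  ∀ (k : ℕ) (c : Fin k → ℕ →₀ ℝ), IsBlockCoeffs c →
    ∀ m : Fin k → ℕ, (∀ j, IsLeast ((c j).support : Set ℕ) (m j)) →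
      C * ‖∑ j, ‖lin x (c j)‖ • tsirelsonUnit θ (m j)‖ ≤ ‖∑ j, lin x (c j)‖

end Estimates

end AsymptoticEllOne

end

noncomputable section

namespace AsymptoticEllOne

/-! Write θ for γ₁. Stabilization says that far out any 𝓢₁-admissible blocks satisfy ‖∑ yᵢ‖ ≥ θ' ∑
‖yᵢ‖ with θ' < θ as close to θ as desired. Using this at each level of the recursion defining the
Tsirelson norm would lose the factor θ'/θ once per level, with no bound on the depth. The proof
arranges a loss that occurs once per coordinate n instead, and makes the product of these losses
exceed 1 - ε.

The mechanism is `norm_le_unfold`. At coordinates from n on, an admissible family with a member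
containing n has at most n + 1 members. Unfolding the norm m times, always inside the member
containing n, leaves aₙ, at most m(n + 1) successive sets to the right of n, and a remainder θᵐ‖a‖.
The weights θ², θ³, … of the deeper pieces may be raised to θ, so one application of the lower
estimate treats all pieces together, and their number is known in advance. Sets to the right of n
are covered by induction with a better constant D(n + 1) (`tsirelson_le_intervalNorm`).

The number of pieces allowed at n can be arbitrary: prepending K vectors of the tail to a block
sequence makes any K of its later blocks 𝓢₁-admissible (`exists_threshold`). Blocks starting
sufficiently late therefore suffice (`exists_sparse`).

The induction bounds the supremum over interval projections, a bimonotone substitute for the norm.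
Returning to the norm costs nothing for a bimonotone sequence. In general, Mazur's construction
gives blocks with basis constant near 1, whose interval projections have norm at most about 2; this
is the source of the factor 1/2. -/

/-- `E < F` for finite sets of indices. -/
def Before (E F : Finset ℕ) : Prop := ∀ a ∈ E, ∀ b ∈ F, a < b

/-! ### Restrictions and unfolding of the Tsirelson norm -/

theorem restr_apply (E : Finset ℕ) (x : ℕ →₀ ℝ) (i : ℕ) :
    restr E x i = if i ∈ E then x i else 0 := by
  rw [restr, Finsupp.filter_apply]

theorem restr_restr (E F : Finset ℕ) (x : ℕ →₀ ℝ) :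
    restr E (restr F x) = restr (E ∩ F) x := by
  ext i
  simp only [restr_apply, Finset.mem_inter]
  split_ifs <;> simp_all

theorem restr_support (E : Finset ℕ) (x : ℕ →₀ ℝ) :
    (restr E x).support = x.support.filter (· ∈ E) :=
  Finsupp.support_filter _ _

theorem restr_eq_self {E : Finset ℕ} {x : ℕ →₀ ℝ} (h : x.support ⊆ E) : restr E x = x := by
  ext i
  rw [restr_apply]
  split_ifs with hi
  · rfl
  · exact (Finsupp.notMem_support_iff.1 fun hx => hi (h hx)).symm

theorem restr_eq_zero {E : Finset ℕ} {x : ℕ →₀ ℝ} (h : ∀ i ∈ x.support, i ∉ E) :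
    restr E x = 0 := by
  ext i
  rw [restr_apply]
  split_ifs with hi
  · exact Finsupp.notMem_support_iff.1 fun hx => h i hx hi
  · rfl

section TsirelsonNorm

variable {θ : ℝ}

theorem iter_restr_le (h0 : 0 ≤ θ) (h1 : θ ≤ 1) (m : ℕ) (E : Finset ℕ) (x : ℕ →₀ ℝ) :
    tsirelsonIter θ m (restr E x) ≤ tsirelsonIter θ m x := by
  induction m generalizing x with
  | zero =>
    refine ciSup_le fun i => ?_
    rw [restr_apply]
    split_ifs
    · exact le_ciSup (bdd_abs x) i
    · simpa using (iter_bounds h1 0 x).1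
  | succ m ih =>
    refine max_le ((ih x).trans (le_max_left _ _))
      (Real.sSup_le ?_ (iter_bounds h1 (m + 1) x).1)
    rintro r ⟨k, F, hF, rfl⟩
    refine le_trans ?_ (le_max_of_le_right
      (le_csSup (bdd_admissibleSums h1 _ (iter_bounds h1 m) x) ⟨k, F, hF, rfl⟩))
    refine mul_le_mul_of_nonneg_left (Finset.sum_le_sum fun i _ => ?_) h0
    rw [restr_restr, Finset.inter_comm, ← restr_restr]
    exact ih _

theorem norm_restr_le (h0 : 0 ≤ θ) (h1 : θ ≤ 1) (E : Finset ℕ) (x : ℕ →₀ ℝ) :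
    tsirelsonNorm θ (restr E x) ≤ tsirelsonNorm θ x :=
  ciSup_le fun m => (iter_restr_le h0 h1 m E x).trans (iter_le_norm h1 m x)

theorem norm_restr_mono (h0 : 0 ≤ θ) (h1 : θ ≤ 1) {E F : Finset ℕ} (h : E ⊆ F) (x : ℕ →₀ ℝ) :
    tsirelsonNorm θ (restr E x) ≤ tsirelsonNorm θ (restr F x) := by
  rw [← Finset.inter_eq_left.2 h, ← restr_restr]
  exact norm_restr_le h0 h1 E _

theorem abs_le_norm (h1 : θ ≤ 1) (x : ℕ →₀ ℝ) (i : ℕ) : |x i| ≤ tsirelsonNorm θ x :=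
  (le_ciSup (bdd_abs x) i).trans (iter_le_norm h1 0 x)

theorem admissible_sum_le_norm (h0 : 0 ≤ θ) (h1 : θ ≤ 1) (x : ℕ →₀ ℝ) {k : ℕ}
    {E : Fin k → Finset ℕ} (hE : Admissible schreierOne E) :
    θ * ∑ i, tsirelsonNorm θ (restr (E i) x) ≤ tsirelsonNorm θ x := by
  obtain ⟨hb, he⟩ := tsirelsonNorm_eq h0 h1 x
  rw [he]
  exact le_max_of_le_right (le_csSup hb ⟨k, E, hE, rfl⟩)

theorem norm_le_of_forall (h0 : 0 ≤ θ) (h1 : θ ≤ 1) (x : ℕ →₀ ℝ) {B : ℝ} (hB : ∀ i, |x i| ≤ B)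
    (h : ∀ (k : ℕ) (E : Fin k → Finset ℕ), Admissible schreierOne E →
      θ * ∑ i, tsirelsonNorm θ (restr (E i) x) ≤ B) : tsirelsonNorm θ x ≤ B := by
  rw [(tsirelsonNorm_eq h0 h1 x).2]
  refine max_le (ciSup_le hB) (Real.sSup_le ?_ ((abs_nonneg _).trans (hB 0)))
  rintro r ⟨k, E, hE, rfl⟩
  exact h k E hE

/-- An admissible family of which one member contains `n` has at most `n + 1` members. -/
theorem Admissible.card_le {k n : ℕ} {E : Fin k → Finset ℕ} (hE : Admissible schreierOne E)
    {i : Fin k} (hn : n ∈ E i) : k ≤ n + 1 := by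
  obtain ⟨hs, m, hm, hS⟩ := hE
  have hinj : Function.Injective m := by
    intro i j hij
    by_contra hne
    rcases lt_or_gt_of_ne hne with h | h
    · exact (hs i j h _ (hm i).1 _ (hm j).1).ne hij
    · exact (hs j i h _ (hm j).1 _ (hm i).1).ne hij.symm
  have h := hS (m i) (Finset.mem_image_of_mem _ (Finset.mem_univ i))
  rw [Finset.card_image_of_injective _ hinj, Finset.card_univ, Fintype.card_fin] at h
  have := (hm i).2 (Finset.mem_coe.2 hn)
  omega

/-- Unfolding the definition of the Tsirelson norm `m` times along the sets that contain the
first coordinate `n`. -/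
theorem norm_le_unfold (h0 : 0 < θ) (h1 : θ ≤ 1) (a : ℕ →₀ ℝ) (n m : ℕ) (G : Finset ℕ)
    (hG : ∀ i ∈ G, n ≤ i) (B : ℝ) (hB : |a n| ≤ B)
    (hBG : tsirelsonNorm θ (restr (G.erase n) a) ≤ B)
    (hl : ∀ l : List (Finset ℕ), l.Pairwise Before → l.length ≤ m * (n + 1) →
      (∀ F ∈ l, F ⊆ G.erase n) →
      θ * (|a n| + (l.map fun F => tsirelsonNorm θ (restr F a)).sum) ≤ B) :
    tsirelsonNorm θ (restr G a) ≤ B + θ ^ m * tsirelsonNorm θ a := by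
  have hN := fun x => (norm_bounds h1 x).1
  induction m generalizing G B with
  | zero =>
    have := norm_restr_le h0.le h1 G a
    have := (abs_nonneg _).trans hB
    simp only [pow_zero, one_mul]
    linarith
  | succ m ih =>
    have hpow : 0 ≤ θ ^ (m + 1) * tsirelsonNorm θ a := mul_nonneg (pow_nonneg h0.le _) (hN a)
    refine norm_le_of_forall h0.le h1 _ (fun i => ?_) fun k E hE => ?_
    · refine le_trans ?_ (le_add_of_nonneg_right hpow)
      rw [restr_apply]
      split_ifs with hi
      · by_cases hin : i = n
        · rwa [hin]
        · refine le_trans ?_ hBG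
          have := abs_le_norm h1 (restr (G.erase n) a) i
          rwa [restr_apply, if_pos (Finset.mem_erase.2 ⟨hin, hi⟩)] at this
      · simpa using (abs_nonneg _).trans hB
    · by_cases hn : ∃ i, n ∈ E i
      · obtain ⟨i₀, hi₀⟩ := hn
        have hk := hE.card_le hi₀
        set F : Fin k → Finset ℕ := fun i => E i ∩ G with hF
        set l₀ : List (Finset ℕ) := ((List.finRange k).filter (· ≠ i₀)).map F with hl₀
        -- Removing the member containing n leaves at most n siblings; the bound n + 1 per level
        -- leaves room for `(F i₀).erase n` as one further set.
        have hlen : l₀.length ≤ n := by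
          rw [hl₀, List.length_map]
          have h2 : ((List.finRange k).filter (· ≠ i₀)).length < (List.finRange k).length :=
            List.length_filter_lt_length_iff_exists.2 ⟨i₀, List.mem_finRange _, by simp⟩
          rw [List.length_finRange] at h2
          omega
        have hsub : ∀ H ∈ l₀, H ⊆ G.erase n := by
          intro H hH
          obtain ⟨i, hi, rfl⟩ := List.mem_map.1 hH
          have hne : i ≠ i₀ := by simpa using (List.mem_filter.1 hi).2
          intro b hb
          obtain ⟨hb1, hb2⟩ := Finset.mem_inter.1 hb
          refine Finset.mem_erase.2 ⟨?_, hb2⟩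
          rintro rfl
          rcases lt_or_gt_of_ne hne with h | h
          · exact lt_irrefl _ (hE.1 _ _ h _ hb1 _ hi₀)
          · exact lt_irrefl _ (hE.1 _ _ h _ hi₀ _ hb1)
        have hpair : l₀.Pairwise Before := by
          rw [hl₀, List.pairwise_map]
          refine ((List.pairwise_lt_finRange k).filter _).imp fun {i j} hij b hb c hc => ?_
          exact hE.1 _ _ hij _ (Finset.mem_inter.1 hb).1 _ (Finset.mem_inter.1 hc).1
        have hafter : ∀ H ⊆ F i₀, ∀ H' ∈ l₀, Before H H' := by
          intro H hH H' hH' b hb c hc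
          obtain ⟨i, hi, rfl⟩ := List.mem_map.1 hH'
          have hne : i ≠ i₀ := by simpa using (List.mem_filter.1 hi).2
          obtain ⟨hb1, -⟩ := Finset.mem_inter.1 (hH hb)
          obtain ⟨hc1, hc2⟩ := Finset.mem_inter.1 hc
          rcases lt_or_gt_of_ne hne with h | h
          -- A member preceding `E i₀` lies to the left of n, so it misses G.
          · exact absurd (hE.1 _ _ h _ hc1 _ hi₀) (not_lt.2 (hG c hc2))
          · exact hE.1 _ _ h _ hb1 _ hc1
        set c : ℝ := (l₀.map fun F => tsirelsonNorm θ (restr F a)).sum with hc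
        have hsum : ∑ i, tsirelsonNorm θ (restr (E i) (restr G a)) =
            tsirelsonNorm θ (restr (F i₀) a) + c := by
          have e1 : c = ∑ i ∈ Finset.univ.erase i₀, tsirelsonNorm θ (restr (F i) a) := by
            rw [hc, hl₀, List.map_map, ← List.sum_toFinset _ ((List.nodup_finRange k).filter _)]
            refine Finset.sum_congr ?_ fun _ _ => rfl
            ext i
            simp
          rw [e1, Finset.add_sum_erase Finset.univ (fun i => tsirelsonNorm θ (restr (F i) a))
            (Finset.mem_univ i₀)]
          exact Finset.sum_congr rfl fun i _ => by rw [restr_restr]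
        -- The siblings are absorbed into the bound: B/θ - c is chosen so that θ(B/θ - c + θᵐ‖a‖ +
        -- c) = B + θᵐ⁺¹‖a‖.
        have key := ih (F i₀) (fun i hi => hG i (Finset.mem_inter.1 hi).2) (B / θ - c) ?_ ?_ ?_
        · rw [hsum]
          calc θ * (tsirelsonNorm θ (restr (F i₀) a) + c)
              ≤ θ * (B / θ - c + θ ^ m * tsirelsonNorm θ a + c) := by gcongr
            _ = B + θ ^ (m + 1) * tsirelsonNorm θ a := by field_simp; ring
        · rw [le_sub_iff_add_le, le_div_iff₀ h0, mul_comm]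
          exact hl l₀ hpair (by nlinarith) hsub
        · rw [le_sub_iff_add_le, le_div_iff₀ h0, mul_comm]
          have h2 := hl ((F i₀).erase n :: l₀)
            (List.pairwise_cons.2 ⟨hafter _ (Finset.erase_subset _ _), hpair⟩)
            (by rw [List.length_cons]; nlinarith) (by
              intro H hH
              rcases List.mem_cons.1 hH with rfl | hH
              · exact Finset.erase_subset_erase _ Finset.inter_subset_right
              · exact hsub H hH)
          refine le_trans (mul_le_mul_of_nonneg_left ?_ h0.le) h2
          rw [List.map_cons, List.sum_cons, ← hc]
          linarith [abs_nonneg (a n)]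
        · intro l hl1 hl2 hl3
          rw [le_sub_iff_add_le, le_div_iff₀ h0, mul_comm]
          have h2 := hl (l ++ l₀)
            (List.pairwise_append.2 ⟨hl1, hpair, fun H hH =>
              hafter H ((hl3 H hH).trans (Finset.erase_subset _ _))⟩)
            (by rw [List.length_append]; nlinarith) (by
              intro H hH
              rcases List.mem_append.1 hH with hH | hH
              · exact (hl3 H hH).trans (Finset.erase_subset_erase _ Finset.inter_subset_right)
              · exact hsub H hH)
          refine le_trans (mul_le_mul_of_nonneg_left ?_ h0.le) h2
          rw [List.map_append, List.sum_append, ← hc, ← add_assoc]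
          gcongr
          -- Here the inner factor θ is dropped: pieces of every depth share the single outer weight
          -- θ.
          refine mul_le_of_le_one_left (add_nonneg (abs_nonneg _) (List.sum_nonneg ?_)) h1
          intro r hr
          obtain ⟨H, -, rfl⟩ := List.mem_map.1 hr
          exact hN _
      -- If no member contains n, the family only sees `G.erase n`, and `hBG` applies.
      · push Not at hn
        refine le_trans ?_ (le_add_of_nonneg_right hpow)
        refine le_trans ?_ ((admissible_sum_le_norm h0.le h1 _ hE).trans hBG)
        refine le_of_eq (congrArg _ (Finset.sum_congr rfl fun i _ => ?_))
        rw [restr_restr, restr_restr]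
        congr 2
        ext b
        simp only [Finset.mem_inter, Finset.mem_erase]
        constructor
        · rintro ⟨h1, h2⟩
          exact ⟨h1, fun h => hn i (h ▸ h1), h2⟩
        · rintro ⟨h1, -, h2⟩
          exact ⟨h1, h2⟩

end TsirelsonNorm

variable {X : Type*} [NormedAddCommGroup X] [NormedSpace ℝ X]

/-! ### Finite linear combinations -/

theorem lin_eq (x : ℕ → X) (a : ℕ →₀ ℝ) : lin x a = Finsupp.linearCombination ℝ x a := rfl

theorem lin_zero (x : ℕ → X) : lin x 0 = 0 := by simp [lin]

theorem lin_add (x : ℕ → X) (a b : ℕ →₀ ℝ) : lin x (a + b) = lin x a + lin x b := by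
  simp only [lin_eq, map_add]

theorem lin_smul (x : ℕ → X) (r : ℝ) (a : ℕ →₀ ℝ) : lin x (r • a) = r • lin x a := by
  simp only [lin_eq, map_smul]

theorem lin_single (x : ℕ → X) (i : ℕ) (r : ℝ) : lin x (Finsupp.single i r) = r • x i := by
  simp [lin_eq]

theorem lin_sum {ι : Type*} (x : ℕ → X) (s : Finset ι) (c : ι → ℕ →₀ ℝ) :
    lin x (∑ i ∈ s, c i) = ∑ i ∈ s, lin x (c i) := by
  simp only [lin_eq, map_sum]

theorem lin_list_sum (x : ℕ → X) (V : List (ℕ →₀ ℝ)) :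
    lin x V.sum = (V.map (lin x)).sum := by
  simp only [lin_eq, map_list_sum]
  rfl

theorem lin_eq_sum (x : ℕ → X) (a : ℕ →₀ ℝ) {S : Finset ℕ} (h : a.support ⊆ S) :
    lin x a = ∑ i ∈ S, a i • x i :=
  Finsupp.sum_of_support_subset _ h _ (by simp)

theorem exists_support_lt (v : ℕ →₀ ℝ) : ∃ b, ∀ i ∈ v.support, i < b :=
  ⟨v.support.sup id + 1, fun _ hi => Nat.lt_succ_of_le (Finset.le_sup (f := id) hi)⟩

/-! ### The bimonotone renorming -/

/-- A finitely supported vector has only finitely many restrictions, so the supremum in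
`intervalNorm` is attained. -/
theorem finite_range_intervals (x : ℕ → X) (v : ℕ →₀ ℝ) :
    (Set.range fun p : ℕ × ℕ => ‖lin x (restr (Finset.Ico p.1 p.2) v)‖).Finite := by
  refine ((v.support.powerset.finite_toSet).image fun E => ‖lin x (restr E v)‖).subset ?_
  rintro _ ⟨p, rfl⟩
  refine ⟨Finset.Ico p.1 p.2 ∩ v.support, by simp, ?_⟩
  change ‖lin x (restr _ v)‖ = ‖lin x (restr _ v)‖
  rw [← restr_restr, restr_eq_self (Finset.Subset.refl v.support)]

/-- The supremum of the norms of the restrictions of `∑ vᵢ xᵢ` to intervals of coordinates. -/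
def intervalNorm (x : ℕ → X) (v : ℕ →₀ ℝ) : ℝ :=
  ⨆ p : ℕ × ℕ, ‖lin x (restr (Finset.Ico p.1 p.2) v)‖

theorem le_intervalNorm (x : ℕ → X) (v : ℕ →₀ ℝ) (s t : ℕ) :
    ‖lin x (restr (Finset.Ico s t) v)‖ ≤ intervalNorm x v :=
  le_ciSup (finite_range_intervals x v).bddAbove (s, t)

theorem exists_intervalNorm (x : ℕ → X) (v : ℕ →₀ ℝ) :
    ∃ s t, intervalNorm x v = ‖lin x (restr (Finset.Ico s t) v)‖ := by
  obtain ⟨p, hp⟩ := (Set.range_nonempty _).csSup_mem (finite_range_intervals x v)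
  exact ⟨p.1, p.2, hp.symm⟩

theorem intervalNorm_nonneg (x : ℕ → X) (v : ℕ →₀ ℝ) : 0 ≤ intervalNorm x v :=
  (norm_nonneg _).trans (le_intervalNorm x v 0 0)

theorem norm_le_intervalNorm (x : ℕ → X) (v : ℕ →₀ ℝ) : ‖lin x v‖ ≤ intervalNorm x v := by
  obtain ⟨b, hb⟩ := exists_support_lt v
  have := le_intervalNorm x v 0 b
  rwa [restr_eq_self fun i hi => Finset.mem_Ico.2 ⟨Nat.zero_le _, hb i hi⟩] at this

/-- Ending the norming interval of v at the first index of w removes w and leaves the part in v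
unchanged. -/
theorem intervalNorm_le_add_right (x : ℕ → X) {v w : ℕ →₀ ℝ} (h : Before v.support w.support) :
    intervalNorm x v ≤ intervalNorm x (v + w) := by
  obtain ⟨s, t, hst⟩ := exists_intervalNorm x v
  by_cases hw : w = 0
  · rw [hw, add_zero]
  have hne := Finsupp.support_nonempty_iff.2 hw
  refine le_trans (le_of_eq ?_) (le_intervalNorm x (v + w) s (min t (w.support.min' hne)))
  rw [hst, restr_add]
  congr 2
  have h2 : restr (Finset.Ico s (min t (w.support.min' hne))) w = 0 := restr_eq_zero fun i hi hI => by
    have := Finset.min'_le _ i hi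
    rw [Finset.mem_Ico] at hI
    omega
  rw [h2, add_zero]
  ext i
  simp only [restr_apply, Finset.mem_Ico]
  by_cases hi : i ∈ v.support
  · have := h i hi _ (Finset.min'_mem _ hne)
    congr 1
    simp only [eq_iff_iff]
    omega
  · simp [Finsupp.notMem_support_iff.1 hi]

theorem intervalNorm_le_add_left (x : ℕ → X) {v w : ℕ →₀ ℝ} (h : Before v.support w.support) :
    intervalNorm x w ≤ intervalNorm x (v + w) := by
  obtain ⟨s, t, hst⟩ := exists_intervalNorm x w
  by_cases hv : v = 0
  · rw [hv, zero_add]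
  have hne := Finsupp.support_nonempty_iff.2 hv
  refine le_trans (le_of_eq ?_) (le_intervalNorm x (v + w) (max s (v.support.max' hne + 1)) t)
  rw [hst, restr_add]
  congr 2
  have h2 : restr (Finset.Ico (max s (v.support.max' hne + 1)) t) v = 0 :=
    restr_eq_zero fun i hi hI => by
      have := Finset.le_max' _ i hi
      rw [Finset.mem_Ico] at hI
      omega
  rw [h2, zero_add]
  ext i
  simp only [restr_apply, Finset.mem_Ico]
  by_cases hi : i ∈ w.support
  · have := h _ (Finset.max'_mem _ hne) i hi
    congr 1
    simp only [eq_iff_iff]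
    omega
  · simp [Finsupp.notMem_support_iff.1 hi]

/-! ### Splitting a vector into successive pieces -/

/-- The vector with coefficients `v` is the sum of at most `k` successive pieces whose norms add
up to at least `r`. -/
def Splits (x : ℕ → X) (v : ℕ →₀ ℝ) (k : ℕ) (r : ℝ) : Prop :=
  ∃ V : List (ℕ →₀ ℝ), V.Pairwise (fun u w => Before u.support w.support) ∧ V.sum = v ∧
    V.length ≤ k ∧ (∀ u ∈ V, u.support ⊆ v.support) ∧ r ≤ (V.map fun u => ‖lin x u‖).sum

theorem splits_one (x : ℕ → X) (v : ℕ →₀ ℝ) : Splits x v 1 ‖lin x v‖ :=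
  ⟨[v], by simp, by simp, by simp, by simp, by simp⟩

theorem Splits.mono {x : ℕ → X} {v : ℕ →₀ ℝ} {k k' : ℕ} {r r' : ℝ} (h : Splits x v k r)
    (hk : k ≤ k') (hr : r' ≤ r) : Splits x v k' r' := by
  obtain ⟨V, h1, h2, h3, h4, h5⟩ := h
  exact ⟨V, h1, h2, h3.trans hk, h4, hr.trans h5⟩

theorem support_add_of_before {v w : ℕ →₀ ℝ} (h : Before v.support w.support) :
    (v + w).support = v.support ∪ w.support :=
  Finsupp.support_add_eq (Finset.disjoint_left.2 fun a ha hb => lt_irrefl _ (h a ha a hb))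

theorem Splits.add {x : ℕ → X} {v w : ℕ →₀ ℝ} {k l : ℕ} {r s : ℝ} (hv : Splits x v k r)
    (hw : Splits x w l s) (h : Before v.support w.support) : Splits x (v + w) (k + l) (r + s) := by
  obtain ⟨V, h1, h2, h3, h4, h5⟩ := hv
  obtain ⟨W, k1, k2, k3, k4, k5⟩ := hw
  refine ⟨V ++ W, List.pairwise_append.2 ⟨h1, k1, fun u hu u' hu' a ha b hb =>
    h a (h4 u hu ha) b (k4 u' hu' hb)⟩, by rw [List.sum_append, h2, k2],
    by rw [List.length_append]; omega, fun u hu => ?_, ?_⟩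
  · rw [support_add_of_before h]
    rcases List.mem_append.1 hu with hu | hu
    · exact (h4 u hu).trans Finset.subset_union_left
    · exact (k4 u hu).trans Finset.subset_union_right
  · rw [List.map_append, List.sum_append]
    exact add_le_add h5 k5

/-- The pieces are the norming interval and what lies on either side of it. The outer pieces must be
kept because the pieces have to sum to v. The last one starts at `max s t` to cover an empty
interval with t < s. -/
theorem splits_intervalNorm (x : ℕ → X) (v : ℕ →₀ ℝ) : Splits x v 3 (intervalNorm x v) := by
  obtain ⟨s, t, hst⟩ := exists_intervalNorm x v
  obtain ⟨b, hb⟩ := exists_support_lt v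
  have hmem : ∀ {i : ℕ} {E : Finset ℕ}, i ∈ (restr E v).support → i ∈ E ∧ i ∈ v.support := by
    intro i E hi
    rw [restr_support, Finset.mem_filter] at hi
    exact hi.symm
  have h1 : Before (restr (Finset.Ico 0 s) v).support (restr (Finset.Ico s t) v).support := by
    intro i hi j hj
    have := Finset.mem_Ico.1 (hmem hi).1
    have := Finset.mem_Ico.1 (hmem hj).1
    omega
  have h2 : Before (restr (Finset.Ico 0 s) v + restr (Finset.Ico s t) v).support
      (restr (Finset.Ico (max s t) b) v).support := by
    intro i hi j hj
    rw [support_add_of_before h1, Finset.mem_union] at hi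
    have hj := Finset.mem_Ico.1 (hmem hj).1
    rcases hi with hi | hi <;> have := Finset.mem_Ico.1 (hmem hi).1 <;> omega
  have h3 : v = restr (Finset.Ico 0 s) v + restr (Finset.Ico s t) v +
      restr (Finset.Ico (max s t) b) v := by
    ext i
    simp only [Finsupp.add_apply, restr_apply, Finset.mem_Ico]
    by_cases hi : i ∈ v.support
    · have := hb i hi
      split_ifs <;> first | omega | simp
    · simp [Finsupp.notMem_support_iff.1 hi]
  have h4 := ((splits_one x (restr (Finset.Ico 0 s) v)).add
    (splits_one x (restr (Finset.Ico s t) v)) h1).add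
    (splits_one x (restr (Finset.Ico (max s t) b) v)) h2
  rw [← h3] at h4
  refine h4.mono le_rfl ?_
  rw [hst]
  linarith [norm_nonneg (lin x (restr (Finset.Ico 0 s) v)),
    norm_nonneg (lin x (restr (Finset.Ico (max s t) b) v))]

/-! ### The lower Tsirelson estimate -/

section Core

variable {θ : ℝ} {x : ℕ → X} {g : ℕ → ℕ →₀ ℝ} {a : ℕ →₀ ℝ}

theorem mem_support_sum {S : Finset ℕ} {k : ℕ} (h : k ∈ (∑ i ∈ S, g i).support) :
    ∃ i ∈ S, k ∈ (g i).support := by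
  by_contra! hc
  refine Finsupp.mem_support_iff.1 h ?_
  rw [Finsupp.finsetSum_apply]
  exact Finset.sum_eq_zero fun i hi => Finsupp.notMem_support_iff.1 (hc i hi)

theorem before_sum (hg : Successive fun i => (g i).support) (s q t : ℕ) :
    Before (∑ i ∈ Finset.Ico s q, g i).support (∑ i ∈ Finset.Ico q t, g i).support := by
  intro k hk l hl
  obtain ⟨i, hi, hk⟩ := mem_support_sum hk
  obtain ⟨j, hj, hl⟩ := mem_support_sum hl
  rw [Finset.mem_Ico] at hi hj
  exact hg i j (by omega) k hk l hl

/-- Estimates on intervals give splittings that dominate any successive family of sets. -/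
theorem splits_of_interval_estimate (h0 : 0 ≤ θ) (h1 : θ ≤ 1)
    (hg : Successive fun i => (g i).support) {D : ℝ} (hD : 0 ≤ D) (t : ℕ)
    (l : List (Finset ℕ)) (hl : l.Pairwise Before) (s : ℕ) (hst : s ≤ t)
    (hls : ∀ F ∈ l, F ⊆ Finset.Ico s t)
    (ih : ∀ s' ≥ s, ∀ q ≤ t, D * tsirelsonNorm θ (restr (Finset.Ico s' q) a) ≤
      intervalNorm x (∑ i ∈ Finset.Ico s' q, g i)) :
    Splits x (∑ i ∈ Finset.Ico s t, g i) (3 * l.length + 1)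
      (D * (l.map fun F => tsirelsonNorm θ (restr F a)).sum) := by
  induction l generalizing s with
  -- What remains to the right of all the sets is one more piece, hence the `+ 1`.
  | nil => exact (splits_one x _).mono (by simp) (by simp)
  | cons F l IH =>
    obtain ⟨hF, hl⟩ := List.pairwise_cons.1 hl
    have hFs := hls F List.mem_cons_self
    -- q is the first index past F: F lies in [s, q) and the later sets in [q, t). The maximum with
    -- s covers an empty F.
    set q : ℕ := max s (F.sup Nat.succ) with hq
    have hsq : s ≤ q := le_max_left _ _
    have hqt : q ≤ t := max_le hst (Finset.sup_le fun b hb => (Finset.mem_Ico.1 (hFs hb)).2)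
    have hFq : F ⊆ Finset.Ico s q := fun b hb => Finset.mem_Ico.2
      ⟨(Finset.mem_Ico.1 (hFs hb)).1,
        (Nat.lt_of_succ_le (Finset.le_sup (f := Nat.succ) hb)).trans_le (le_max_right _ _)⟩
    have hlq : ∀ H ∈ l, H ⊆ Finset.Ico q t := by
      intro H hH b hb
      have hb' := Finset.mem_Ico.1 (hls H (List.mem_cons_of_mem _ hH) hb)
      refine Finset.mem_Ico.2 ⟨max_le hb'.1 (Finset.sup_le fun c hc => ?_), hb'.2⟩
      exact hF H hH c hc b hb
    have key := ((splits_intervalNorm x _).mono le_rfl (ih s le_rfl q hqt)).add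
      (IH hl q hqt hlq fun s' hs' => ih s' (hsq.trans hs')) (before_sum hg s q t)
    rw [Finset.sum_Ico_consecutive _ hsq hqt] at key
    refine key.mono (by rw [List.length_cons]; omega) ?_
    rw [List.map_cons, List.sum_cons, mul_add]
    gcongr
    exact norm_restr_mono h0 h1 hFq a

/-- Induction on the length of the interval. Passing from n + 1 to n costs the factor τ n (the lower
estimate H is applied once) and the factor 1 - θ ^ m n (the remainder of the unfolding); `hD` says
that D pays for both. -/
theorem tsirelson_le_intervalNorm (h0 : 0 < θ) (h1 : θ ≤ 1) {D τ : ℕ → ℝ} {m : ℕ → ℕ}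
    (hDm : Monotone D) (hD0 : ∀ n, 0 < D n) (hD1 : ∀ n, D n ≤ 1) (hτ0 : ∀ n, 0 < τ n) (hτ1 : ∀ n, τ n ≤ 1)
    (hD : ∀ n, D n ≤ (1 - θ ^ m n) * (D (n + 1) * τ n))
    (H : ∀ n v r, (∀ i ∈ v.support, n ≤ i) →
      Splits x v (3 * (m n * (n + 1)) + 2) r → θ * τ n * r ≤ ‖lin x v‖)
    (hg : Successive fun i => (g i).support) (hgi : ∀ i, ∀ k ∈ (g i).support, i ≤ k)
    (ha : ∀ i, |a i| ≤ ‖lin x (g i)‖) (t n : ℕ) :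
    D n * tsirelsonNorm θ (restr (Finset.Ico n t) a) ≤
      intervalNorm x (∑ i ∈ Finset.Ico n t, g i) := by
  induction hk : t - n using Nat.strong_induction_on generalizing n t with
  | _ k ih =>
  subst hk
  rcases le_or_gt t n with hnt | hnt
  · rw [Finset.Ico_eq_empty_of_le hnt, (norm_eq_zero_iff' h1 _).2 (restr_eq_zero (by simp)),
      mul_zero]
    exact intervalNorm_nonneg _ _
  set v := ∑ i ∈ Finset.Ico n t, g i with hv
  set a' := restr (Finset.Ico n t) a with ha'
  have hsub : ∀ F ⊆ Finset.Ico n t, restr F a' = restr F a := fun F hF => by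
    rw [ha', restr_restr, Finset.inter_eq_left.2 hF]
  have herase : (Finset.Ico n t).erase n = Finset.Ico (n + 1) t := by
    ext i
    simp only [Finset.mem_erase, Finset.mem_Ico]
    omega
  have hN := fun y => (norm_bounds h1 y).1
  have hd : 0 < D (n + 1) * τ n := mul_pos (hD0 _) (hτ0 _)
  have hdle : D (n + 1) * τ n ≤ D (n + 1) := mul_le_of_le_one_right (hD0 _).le (hτ1 n)
  have hQ := intervalNorm_nonneg x v
  have hsplit : v = g n + ∑ i ∈ Finset.Ico (n + 1) t, g i := by
    rw [hv, Finset.sum_eq_sum_Ico_succ_bot hnt]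
  have hbef : Before (g n).support (∑ i ∈ Finset.Ico (n + 1) t, g i).support := by
    have := before_sum hg n (n + 1) t
    rwa [Nat.Ico_succ_singleton, Finset.sum_singleton] at this
  have IH : ∀ s' ≥ n + 1, ∀ q ≤ t,
      D (n + 1) * tsirelsonNorm θ (restr (Finset.Ico s' q) a) ≤
        intervalNorm x (∑ i ∈ Finset.Ico s' q, g i) := by
    intro s' hs' q hq
    exact (mul_le_mul_of_nonneg_right (hDm hs') (hN _)).trans (ih (q - s') (by omega) q s' rfl)
  -- Unfolding the truncated vector a' makes the remainder θᵐ‖a'‖, which can be absorbed on the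
  -- left.
  have hmain := norm_le_unfold h0 h1 a' n (m n) (Finset.Ico n t)
    (fun i hi => (Finset.mem_Ico.1 hi).1) (intervalNorm x v / (D (n + 1) * τ n)) ?_ ?_ ?_
  · rw [hsub _ le_rfl, ← ha'] at hmain
    have h2 : (1 - θ ^ m n) * tsirelsonNorm θ a' ≤ intervalNorm x v / (D (n + 1) * τ n) := by
      linarith
    rw [le_div_iff₀ hd] at h2
    calc D n * tsirelsonNorm θ a'
        ≤ (1 - θ ^ m n) * (D (n + 1) * τ n) * tsirelsonNorm θ a' := by
          gcongr
          · exact hN _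
          · exact hD n
      _ ≤ intervalNorm x v := by linarith
  · rw [le_div_iff₀ hd, ha', restr_apply, if_pos (Finset.mem_Ico.2 ⟨le_rfl, hnt⟩)]
    calc |a n| * (D (n + 1) * τ n) ≤ |a n| :=
          mul_le_of_le_one_right (abs_nonneg _) (hdle.trans (hD1 _))
      _ ≤ ‖lin x (g n)‖ := ha n
      _ ≤ intervalNorm x (g n) := norm_le_intervalNorm _ _
      _ ≤ intervalNorm x v := hsplit ▸ intervalNorm_le_add_right x hbef
  · rw [le_div_iff₀ hd, herase, hsub _ (Finset.Ico_subset_Ico_left n.le_succ)]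
    calc tsirelsonNorm θ (restr (Finset.Ico (n + 1) t) a) * (D (n + 1) * τ n)
        ≤ D (n + 1) * tsirelsonNorm θ (restr (Finset.Ico (n + 1) t) a) := by
          rw [mul_comm]
          exact mul_le_mul_of_nonneg_right hdle (hN _)
      _ ≤ intervalNorm x (∑ i ∈ Finset.Ico (n + 1) t, g i) := IH _ le_rfl t le_rfl
      _ ≤ intervalNorm x v := hsplit ▸ intervalNorm_le_add_left x hbef
  · intro l hl hlen hlG
    rw [herase] at hlG
    have e1 : (l.map fun F => tsirelsonNorm θ (restr F a')) =
        l.map fun F => tsirelsonNorm θ (restr F a) :=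
      List.map_congr_left fun F hF => by
        rw [hsub F ((hlG F hF).trans (Finset.Ico_subset_Ico_left n.le_succ))]
    rw [e1, le_div_iff₀ hd, ha', restr_apply, if_pos (Finset.mem_Ico.2 ⟨le_rfl, hnt⟩)]
    have hs := (splits_one x (g n)).add (splits_of_interval_estimate h0.le h1 hg (hD0 _).le t l hl
      (n + 1) hnt hlG IH) hbef
    rw [← hsplit] at hs
    -- One piece for `g n`, three for each of at most m(n + 1) sets, one for what is left over.
    have hH := H n v _ (fun k hk => ?_) (hs.mono (k' := 3 * (m n * (n + 1)) + 2) (by omega) le_rfl)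
    · refine le_trans ?_ (hH.trans (norm_le_intervalNorm x v))
      have h3 : D (n + 1) * |a n| ≤ ‖lin x (g n)‖ :=
        (mul_le_of_le_one_left (abs_nonneg _) (hD1 _)).trans (ha n)
      have h4 : 0 ≤ θ * τ n := mul_nonneg h0.le (hτ0 n).le
      set S := (l.map fun F => tsirelsonNorm θ (restr F a)).sum
      calc θ * (|a n| + S) * (D (n + 1) * τ n) = θ * τ n * (D (n + 1) * |a n| + D (n + 1) * S) := by
            ring
        _ ≤ θ * τ n * (‖lin x (g n)‖ + D (n + 1) * S) := by gcongr
    · obtain ⟨i, hi, hk⟩ := mem_support_sum hk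
      exact (Finset.mem_Ico.1 hi).1.trans (hgi i k hk)

end Core

/-! ### Lower estimates from `Δ`-stabilization -/

theorem schreierOne_subset (L : Ordinal.{0} → ℕ → Ordinal.{0}) :
    schreierOne ⊆ schreier L 1 := by
  intro F hF
  rw [← zero_add (1 : Ordinal.{0}), schreier_add_one, schreier_zero]
  have himg : Finset.univ.image (F.orderEmbOfFin rfl) = F := by
    simp
  refine ⟨F.card, fun i => {F.orderEmbOfFin rfl i}, ⟨?_, F.orderEmbOfFin rfl, ?_, ?_⟩, ?_, ?_⟩
  · intro i j hij a ha b hb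
    rw [Finset.mem_singleton] at ha hb
    rw [ha, hb]
    exact (F.orderEmbOfFin rfl).strictMono hij
  · intro i
    simp
  · rw [himg]
    exact hF
  · exact fun i => Or.inr ⟨_, rfl⟩
  · ext b
    simp only [Finset.mem_biUnion, Finset.mem_univ, true_and, Finset.mem_singleton]
    conv_lhs => rw [← himg]
    rw [Finset.mem_image]
    simp only [Finset.mem_univ, true_and, eq_comm]

/-- The sequence `u` with the coordinate `p + i` moved to `q + i`. -/
def shift (p q : ℕ) (u : ℕ →₀ ℝ) : ℕ →₀ ℝ :=
  (u.comapDomain (addLeftEmbedding p) (addLeftEmbedding p).injective.injOn).embDomain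
    (addLeftEmbedding q)

theorem mem_support_shift {p q k : ℕ} {u : ℕ →₀ ℝ} :
    k ∈ (shift p q u).support ↔ ∃ i, k = q + i ∧ p + i ∈ u.support := by
  rw [shift, Finsupp.support_embDomain, Finset.mem_map]
  simp only [Finsupp.comapDomain_support, Finset.mem_preimage, addLeftEmbedding_apply]
  exact ⟨fun ⟨i, h1, h2⟩ => ⟨i, h2.symm, h1⟩, fun ⟨i, h1, h2⟩ => ⟨i, h2, h1.symm⟩⟩

theorem lin_shift {x y : ℕ → X} {p q : ℕ} (h : ∀ i, y (q + i) = x (p + i)) {u : ℕ →₀ ℝ}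
    (hu : ∀ i ∈ u.support, p ≤ i) : lin y (shift p q u) = lin x u := by
  have e1 : u = (u.comapDomain (addLeftEmbedding p)
      (addLeftEmbedding p).injective.injOn).embDomain (addLeftEmbedding p) := by
    refine (Finsupp.embDomain_comapDomain fun i hi => ?_).symm
    exact ⟨i - p, Nat.add_sub_cancel' (hu i hi)⟩
  conv_rhs => rw [e1]
  rw [shift, lin_eq, lin_eq, Finsupp.linearCombination_embDomain,
    Finsupp.linearCombination_embDomain]
  congr 2
  funext i
  exact h i

theorem before_shift {p q : ℕ} {u w : ℕ →₀ ℝ} (h : Before u.support w.support) :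
    Before (shift p q u).support (shift p q w).support := by
  intro k hk l hl
  obtain ⟨i, rfl, hi⟩ := mem_support_shift.1 hk
  obtain ⟨j, rfl, hj⟩ := mem_support_shift.1 hl
  have := h _ hi _ hj
  omega

theorem shift_ne_zero {p q : ℕ} {u : ℕ →₀ ℝ} (hu0 : u ≠ 0) (hu : ∀ i ∈ u.support, p ≤ i) :
    shift p q u ≠ 0 := by
  obtain ⟨i, hi⟩ := Finsupp.support_nonempty_iff.2 hu0
  rw [← Finsupp.support_nonempty_iff]
  exact ⟨q + (i - p), mem_support_shift.2 ⟨_, rfl, by rwa [Nat.add_sub_cancel' (hu i hi)]⟩⟩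

theorem admissible_of_card_le {k : ℕ} {E : Fin k → Finset ℕ} (hE : Successive E)
    (hne : ∀ i, (E i).Nonempty) (hk : ∀ i, ∀ b ∈ E i, k ≤ b + 1) :
    Admissible schreierOne E := by
  refine ⟨hE, fun i => (E i).min' (hne i), fun i => (E i).isLeast_min' _, ?_⟩
  intro b hb
  obtain ⟨i, -, rfl⟩ := Finset.mem_image.1 hb
  refine (Finset.card_image_le.trans ?_).trans (hk i _ (Finset.min'_mem _ _))
  simp

theorem exists_of_lt_deltaConst {𝓕 : Set (Finset ℕ)} {y : ℕ → X} {δ : ℝ}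
    (h : δ < deltaConst 𝓕 y) (k : ℕ) (c : Fin k → ℕ →₀ ℝ) (hc : IsBlockCoeffs c)
    (hadm : Admissible 𝓕 fun i => (c i).support) :
    δ * ∑ i, ‖lin y (c i)‖ ≤ ‖∑ i, lin y (c i)‖ := by
  obtain ⟨δ', hδ', hlt⟩ := exists_lt_of_lt_csSup (by exact ⟨0, le_rfl, fun k c _ _ => by simp⟩) h
  refine le_trans ?_ (hδ'.2 k c hc hadm)
  gcongr

theorem sum_map_filter_ne_zero {A M : Type*} [Zero A] [DecidableEq A] [AddCommMonoid M]
    (V : List A) {f : A → M} (hf : f 0 = 0) :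
    ((V.filter (· ≠ 0)).map f).sum = (V.map f).sum := by
  induction V with
  | nil => rfl
  | cons u V ih =>
    by_cases hu : u = 0
    · rw [List.filter_cons_of_neg (by simpa using hu), ih, List.map_cons, List.sum_cons, hu, hf,
        zero_add]
    · rw [List.filter_cons_of_pos (by simpa using hu), List.map_cons, List.map_cons, List.sum_cons,
        List.sum_cons, ih]

theorem sum_get {A M : Type*} [AddCommMonoid M] (W : List A) (f : A → M) :
    ∑ i, f (W.get i) = (W.map f).sum := by
  conv_rhs => rw [← List.ofFn_get W, List.map_ofFn, List.sum_ofFn]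
  rfl

/-- Blocks must be non-zero, so zero pieces are discarded; they contribute to neither sum. -/
theorem Splits.exists_ne_zero {x : ℕ → X} {v : ℕ →₀ ℝ} {K : ℕ} {r : ℝ} (h : Splits x v K r) :
    ∃ (k : ℕ) (c : Fin k → ℕ →₀ ℝ), k ≤ K ∧ IsBlockCoeffs c ∧
      (∀ i, (c i).support ⊆ v.support) ∧ ∑ i, lin x (c i) = lin x v ∧
      r ≤ ∑ i, ‖lin x (c i)‖ := by
  classical
  obtain ⟨V, h1, h2, h3, h4, h5⟩ := h
  set W := V.filter (· ≠ 0) with hW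
  have hmem : ∀ i, W.get i ∈ V ∧ W.get i ≠ 0 := fun i => by
    simpa using List.mem_filter.1 (List.get_mem W i)
  refine ⟨W.length, W.get, (List.length_filter_le _ _).trans h3, ⟨fun i => (hmem i).2, ?_⟩,
    fun i => h4 _ (hmem i).1, ?_, ?_⟩
  · intro i j hij
    exact List.pairwise_iff_get.1 (h1.filter _) i j hij
  · rw [sum_get W (lin x), sum_map_filter_ne_zero V (lin_zero x), ← lin_list_sum, h2]
  · rw [sum_get W fun u => ‖lin x u‖,
      sum_map_filter_ne_zero (f := fun u => ‖lin x u‖) V (by simp [lin_zero])]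
    exact h5

/-- Membership in 𝓢₁ limits the number of pieces by the first index. With K vectors put in front,
the blocks from n on have index at least K, so K pieces are admissible whatever n is. The
stabilization hypothesis applies because it concerns all block bases of a tail, including the
prolonged one. -/
theorem exists_threshold {L : Ordinal.{0} → ℕ → Ordinal.{0}} {z : ℕ → X} {γ : Ordinal.{0} → ℝ}
    (hγ : DeltaStabilizes L z γ) {δ : ℝ} (h0 : 0 ≤ δ) (hδ : δ < γ 1) (K : ℕ) :
    ∃ N : ℕ, ∀ (d : ℕ → ℕ →₀ ℝ), IsBlockCoeffs d → ∀ n : ℕ,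
      (∀ j ≥ n, ∀ k ∈ (d j).support, N ≤ k) → ∀ v r, (∀ i ∈ v.support, n ≤ i) →
      Splits (fun i => lin z (d i)) v K r → δ * r ≤ ‖lin (fun i => lin z (d i)) v‖ := by
  obtain ⟨ε, -, hε0, hε⟩ := hγ
  obtain ⟨m, hm⟩ := hε 1 (Ordinal.one_lt_omega0.trans_le (Ordinal.omega0_le_omega 1))
  obtain ⟨N, hN1, hN2⟩ := ((hε0.eventually_lt_const (sub_pos.2 hδ)).and
    (eventually_ge_atTop m)).exists
  -- The offset K leaves room for z_N, …, z_{N+K-1} before the blocks.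
  refine ⟨N + K, fun d hd n hn v r hv hs => ?_⟩
  obtain ⟨k, c, hkK, hc, hcv, hsum, hr⟩ := hs.exists_ne_zero
  set x : ℕ → X := fun i => lin z (d i) with hx
  let y : ℕ → X := fun i => if i < K then z (N + i) else x (n + (i - K))
  have hdN : ∀ i, K ≤ i → ∀ b ∈ (d (n + (i - K))).support, N + K ≤ b :=
    fun i _ b hb => hn _ (Nat.le_add_right _ _) b hb
  have hy : IsBlockBasis (fun i => z (N + i)) y := by
    refine ⟨fun i => if i < K then Finsupp.single i 1 else shift N 0 (d (n + (i - K))),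
      ⟨fun i => ?_, fun i j hij => ?_⟩, fun i => ?_⟩
    · dsimp only
      split_ifs with hi
      · simp
      · exact shift_ne_zero (hd.1 _) fun b hb =>
          (Nat.le_add_right N K).trans (hdN i (not_lt.1 hi) b hb)
    · have hs1 : ∀ i : ℕ, (Finsupp.single i (1 : ℝ)).support = {i} := fun i =>
        Finsupp.support_single _ one_ne_zero
      dsimp only
      split_ifs with hi hj hj
      · intro a ha b hb
        rw [hs1, Finset.mem_singleton] at ha hb
        omega
      · intro a ha b hb
        rw [hs1, Finset.mem_singleton] at ha
        obtain ⟨l, rfl, hl⟩ := mem_support_shift.1 hb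
        have := hdN j (not_lt.1 hj) _ hl
        omega
      · omega
      · exact before_shift (hd.2 _ _ (by omega))
    · change (if i < K then z (N + i) else x (n + (i - K))) =
        lin (fun i => z (N + i)) (if i < K then _ else _)
      split_ifs with hi
      · rw [lin_single, one_smul]
      · exact (lin_shift (x := z) (y := fun i => z (N + i)) (fun i => by rw [zero_add])
          fun b hb => (Nat.le_add_right N K).trans (hdN i (not_lt.1 hi) b hb)).symm
  have hδy : δ < deltaConst (schreier L 1) y := by
    have h1 := hm N hN2 y hy
    rw [abs_lt] at h1
    linarith
  have hcn : ∀ i, ∀ b ∈ (c i).support, n ≤ b := fun i b hb => hv b (hcv i hb)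
  have hyx : ∀ i, lin y (shift n K (c i)) = lin x (c i) := fun i =>
    lin_shift (fun j => by simp [y]) (hcn i)
  have hsucc : Successive fun i => (shift n K (c i)).support :=
    fun i j hij => before_shift (hc.2 i j hij)
  have hadm : Admissible (schreier L 1) fun i => (shift n K (c i)).support := by
    obtain ⟨h1, m, h2, h3⟩ := admissible_of_card_le hsucc
      (fun i => Finsupp.support_nonempty_iff.2 (shift_ne_zero (hc.1 i) (hcn i)))
      (fun i b hb => by
        obtain ⟨l, rfl, -⟩ := mem_support_shift.1 hb
        omega)
    exact ⟨h1, m, h2, schreierOne_subset L h3⟩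
  have key := exists_of_lt_deltaConst hδy k (fun i => shift n K (c i))
    ⟨fun i => shift_ne_zero (hc.1 i) (hcn i), hsucc⟩ hadm
  simp only [hyx, hsum] at key
  exact (mul_le_mul_of_nonneg_left hr h0).trans key

/-! ### Sparse block sequences and the resulting lower estimates -/

/-- The lower `T_θ` estimate with constant `c` for successive vectors `gᵢ` whose supports start
not before `i`. -/
def SuccessiveLowerEstimate (θ c : ℝ) (x : ℕ → X) : Prop :=
  ∀ (g : ℕ → ℕ →₀ ℝ) (a : ℕ →₀ ℝ), (Successive fun i => (g i).support) →
    (∀ i, ∀ k ∈ (g i).support, i ≤ k) → (∀ i, |a i| ≤ ‖lin x (g i)‖) → ∀ t,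
    c * tsirelsonNorm θ (restr (Finset.Ico 0 t) a) ≤ ‖lin x (∑ i ∈ Finset.Ico 0 t, g i)‖

theorem exists_sparse {L : Ordinal.{0} → ℕ → Ordinal.{0}} {z : ℕ → X} {γ : Ordinal.{0} → ℝ}
    (hγ : DeltaStabilizes L z γ) (hγ1 : γ 1 ∈ Set.Ioo (0 : ℝ) 1) {ε : ℝ} (hε0 : 0 < ε)
    (hε1 : ε < 1) : ∃ ψ : ℕ → ℕ, Monotone ψ ∧ ∀ d : ℕ → ℕ →₀ ℝ, IsBlockCoeffs d →
      (∀ n, ∀ k ∈ (d n).support, ψ n ≤ k) → ∀ C : ℝ, 0 < C →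
      (∀ v, intervalNorm (fun i => lin z (d i)) v ≤ C * ‖lin (fun i => lin z (d i)) v‖) →
      SuccessiveLowerEstimate (γ 1) ((1 - ε) / C) fun i => lin z (d i) := by
  set θ := γ 1
  -- D increases from exactly 1 - ε towards 1, so the losses at all coordinates together stay within
  -- ε.
  set D : ℕ → ℝ := fun n => 1 - ε / (n + 1) with hDdef
  have hDlt : ∀ n, D n < D (n + 1) := fun n => by
    simp only [hDdef]
    push_cast
    gcongr
    linarith
  have hDm : Monotone D := monotone_nat_of_le_succ fun n => (hDlt n).le
  have hD0 : ∀ n, 0 < D n := fun n =>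
    lt_of_lt_of_le (by simp [hDdef, hε1]) (hDm (Nat.zero_le n))
  have hD1 : ∀ n, D n ≤ 1 := fun n => by
    have : 0 ≤ ε / ((n : ℝ) + 1) := by positivity
    simp only [hDdef]
    linarith
  -- Half the relative gap: (1 - κ)² ≥ 1 - 2κ = D n / D (n + 1), one factor for τ and one for the
  -- remainder θᵐ < κ.
  set κ : ℕ → ℝ := fun n => (1 - D n / D (n + 1)) / 2 with hκdef
  have hκ0 : ∀ n, 0 < κ n := fun n => by
    have := (div_lt_one (hD0 (n + 1))).2 (hDlt n)
    simp only [hκdef]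
    linarith
  have hκ1 : ∀ n, κ n < 1 := fun n => by
    have := div_pos (hD0 n) (hD0 (n + 1))
    simp only [hκdef]
    linarith
  choose m hm using fun n => exists_pow_lt_of_lt_one (hκ0 n) hγ1.2
  have hθτ : ∀ n, θ * (1 - κ n) < θ := fun n => mul_lt_of_lt_one_right hγ1.1 (by linarith [hκ0 n])
  have hθτ0 : ∀ n, 0 ≤ θ * (1 - κ n) := fun n =>
    mul_nonneg hγ1.1.le (by linarith [hκ1 n])
  choose N hN using fun n => exists_threshold hγ (hθτ0 n) (hθτ n) (3 * (m n * (n + 1)) + 2)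
  -- Partial sums give a monotone sequence dominating every earlier threshold.
  refine ⟨fun n => ∑ i ∈ Finset.range (n + 1), N i, fun n n' h => ?_, ?_⟩
  · exact Finset.sum_le_sum_of_subset (Finset.range_mono (by omega))
  · intro d hd hdψ C hC hQ g a hg hgi ha t
    have key := tsirelson_le_intervalNorm hγ1.1 hγ1.2.le (τ := fun n => 1 - κ n) (m := m) hDm hD0
      hD1 (fun n => by linarith [hκ1 n]) (fun n => by linarith [hκ0 n]) (fun n => ?_)
      (fun n v r hv hs => hN n d hd n (fun j hj k hk => ?_) v r hv hs) hg hgi ha t 0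
    · have e1 : D 0 = 1 - ε := by simp [hDdef]
      rw [e1] at key
      rw [div_mul_eq_mul_div, div_le_iff₀ hC, mul_comm _ C]
      exact key.trans (hQ _)
    · have h1 : D n = D (n + 1) * (1 - 2 * κ n) := by
        have := (hD0 (n + 1)).ne'
        simp only [hκdef]
        field_simp
        ring
      have h2 : 1 - κ n ≤ 1 - θ ^ m n := by linarith [hm n]
      calc D n = D (n + 1) * (1 - 2 * κ n) := h1
        _ ≤ D (n + 1) * ((1 - κ n) * (1 - κ n)) := by
            gcongr
            · exact (hD0 _).le
            · nlinarith [sq_nonneg (κ n)]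
        _ ≤ D (n + 1) * ((1 - θ ^ m n) * (1 - κ n)) := by
            gcongr
            · exact (hD0 _).le
            · linarith [hκ1 n]
        _ = _ := by ring
    · refine le_trans ?_ (hdψ j k hk)
      exact Finset.single_le_sum (f := N) (fun _ _ => Nat.zero_le _)
        (Finset.mem_range.2 (by omega))

/-- Take `g i` to be a multiple of the i-th unit vector. The positive constant c, rather than c',
which may be negative, transfers the Cauchy property to the Tsirelson space. -/
theorem SuccessiveLowerEstimate.lowerEstimate {θ : Set.Ioo (0 : ℝ) 1} {c c' : ℝ} {x : ℕ → X}
    (h : SuccessiveLowerEstimate θ c x) (hx : ∀ i, ‖x i‖ = 1) (hc : 0 < c) (hc' : c' ≤ c) :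
    LowerEstimate θ c' x := by
  have hfin : ∀ a : ℕ →₀ ℝ, c * ‖lin (tsirelsonUnit θ) a‖ ≤ ‖lin x a‖ := by
    intro a
    rw [lin_tsirelsonUnit, norm_toTsirelson]
    obtain ⟨t, ht⟩ := exists_support_lt a
    have hsub : a.support ⊆ Finset.Ico 0 t := fun i hi => Finset.mem_Ico.2 ⟨Nat.zero_le _, ht i hi⟩
    have hsupp : ∀ i k, k ∈ (Finsupp.single i (a i)).support → k = i := fun i k hk =>
      Finset.mem_singleton.1 (Finsupp.support_single_subset hk)
    have key := h (fun i => Finsupp.single i (a i)) a (fun i j hij b hb k hk => by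
      rw [hsupp i b hb, hsupp j k hk]; exact hij) (fun i k hk => (hsupp i k hk).ge)
      (fun i => by rw [lin_single, norm_smul, hx, mul_one, Real.norm_eq_abs]) t
    rw [restr_eq_self hsub, lin_sum] at key
    simp only [lin_single] at key
    rwa [lin_eq_sum x a hsub]
  refine ⟨fun a => le_trans (by gcongr) (hfin a), fun a v hv => ?_⟩
  have hle : ∀ s : Finset ℕ, c * ‖∑ i ∈ s, a i • tsirelsonUnit θ i‖ ≤ ‖∑ i ∈ s, a i • x i‖ := by
    intro s
    have := hfin (∑ i ∈ s, Finsupp.single i (a i))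
    simpa only [lin_sum, lin_single] using this
  have hcauchy : CauchySeq fun n => ∑ i ∈ Finset.range n, a i • tsirelsonUnit θ i := by
    rw [Metric.cauchySeq_iff']
    intro δ hδ
    obtain ⟨N, hN⟩ := Metric.cauchySeq_iff'.1 hv.cauchySeq (c * δ) (mul_pos hc hδ)
    refine ⟨N, fun n hn => ?_⟩
    have h1 := hN n hn
    rw [dist_eq_norm, ← Finset.sum_Ico_eq_sub _ hn] at h1 ⊢
    exact lt_of_mul_lt_mul_left ((hle _).trans_lt h1) hc.le
  obtain ⟨t, ht⟩ := cauchySeq_tendsto_of_complete hcauchy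
  refine ⟨t, ht, (mul_le_mul_of_nonneg_right hc' (norm_nonneg t)).trans ?_⟩
  exact le_of_tendsto_of_tendsto' (ht.norm.const_mul c) hv.norm fun n => hle _

/-- Each block is placed at the index of its first coordinate, with zero vectors at all other
indices. -/
theorem SuccessiveLowerEstimate.lowerBlockEstimate {θ : Set.Ioo (0 : ℝ) 1} {c c' : ℝ} {x : ℕ → X}
    (h : SuccessiveLowerEstimate θ c x) (hc' : c' ≤ c) : LowerBlockEstimate θ c' x := by
  intro k b hb m hm
  have hlt : ∀ i j, i < j → m i < m j := fun i j hij => hb.2 i j hij _ (hm i).1 _ (hm j).1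
  have hmono : StrictMono m := fun i j hij => hlt i j hij
  set g : ℕ → ℕ →₀ ℝ := Function.extend m b 0 with hg
  have hgm : ∀ j, g (m j) = b j := fun j => hmono.injective.extend_apply _ _ j
  have hg0 : ∀ i, (∀ j, m j ≠ i) → g i = 0 := fun i hi =>
    Function.extend_apply' _ _ _ fun ⟨j, hj⟩ => hi j hj
  have hgmem : ∀ i l, l ∈ (g i).support → ∃ j, m j = i ∧ l ∈ (b j).support := by
    intro i l hl
    by_cases hi : ∃ j, m j = i
    · obtain ⟨j, rfl⟩ := hi
      exact ⟨j, rfl, hgm j ▸ hl⟩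
    · push Not at hi
      rw [hg0 i hi] at hl
      simp at hl
  set S : Finset ℕ := Finset.univ.image m with hS
  have hS0 : ∀ i, i ∉ S → g i = 0 := fun i hi => hg0 i fun j hj =>
    hi (Finset.mem_image.2 ⟨j, Finset.mem_univ _, hj⟩)
  set a : ℕ →₀ ℝ := Finsupp.onFinset S (fun i => ‖lin x (g i)‖) (fun i hi => by
    by_contra hiS
    exact hi (by rw [hS0 i hiS, lin_zero, norm_zero])) with ha
  have hai : ∀ i, a i = ‖lin x (g i)‖ := fun i => rfl
  have haS : a.support ⊆ S := Finsupp.support_onFinset_subset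
  obtain ⟨t, ht⟩ : ∃ t, ∀ i ∈ S, i < t :=
    ⟨S.sup id + 1, fun _ hi => Nat.lt_succ_of_le (Finset.le_sup (f := id) hi)⟩
  have hSt : S ⊆ Finset.Ico 0 t := fun i hi => Finset.mem_Ico.2 ⟨Nat.zero_le _, ht i hi⟩
  have key := h g a (fun i j hij p hp q hq => by
      obtain ⟨i', rfl, hp'⟩ := hgmem i p hp
      obtain ⟨j', rfl, hq'⟩ := hgmem j q hq
      exact hb.2 i' j' (hmono.lt_iff_lt.1 hij) p hp' q hq')
    (fun i l hl => by
      obtain ⟨j, rfl, hl'⟩ := hgmem i l hl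
      exact (hm j).2 hl')
    (fun i => by rw [hai, abs_of_nonneg (norm_nonneg _)]) t
  rw [restr_eq_self (haS.trans hSt), ← norm_toTsirelson, ← lin_tsirelsonUnit,
    ← Finset.sum_subset hSt fun i _ hi => hS0 i hi, lin_eq_sum _ a haS, hS,
    Finset.sum_image fun i _ j _ hij => hmono.injective hij,
    Finset.sum_image fun i _ j _ hij => hmono.injective hij, lin_sum] at key
  simp only [hai, hgm] at key
  exact (mul_le_mul_of_nonneg_right hc' (norm_nonneg _)).trans key

/-! ### Subsequences of bimonotone sequences -/

/-- On the span of the subsequence, projecting onto [s, t) is projecting onto [φ s, φ t) for z. -/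
theorem IsBimonotone.intervalNorm_comp_le {z : ℕ → X} (hz : IsBimonotone z) {φ : ℕ → ℕ}
    (hφ : StrictMono φ) (v : ℕ →₀ ℝ) :
    intervalNorm (fun i => z (φ i)) v ≤ ‖lin (fun i => z (φ i)) v‖ := by
  refine ciSup_le fun p => ?_
  set f : ℕ ↪ ℕ := ⟨φ, hφ.injective⟩ with hf
  have hlin : ∀ w : ℕ →₀ ℝ, lin (fun i => z (φ i)) w = lin z (w.embDomain f) := fun w => by
    rw [lin_eq, lin_eq, Finsupp.linearCombination_embDomain]
    rfl
  have hres : (restr (Finset.Ico p.1 p.2) v).embDomain f =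
      restr (Finset.Ico (φ p.1) (φ p.2)) (v.embDomain f) := by
    ext i
    by_cases hi : i ∈ Set.range f
    · obtain ⟨j, rfl⟩ := hi
      have : f j ∈ Finset.Ico (φ p.1) (φ p.2) ↔ j ∈ Finset.Ico p.1 p.2 := by
        rw [Finset.mem_Ico, Finset.mem_Ico]
        exact and_congr hφ.le_iff_le hφ.lt_iff_lt
      simp only [restr_apply, Finsupp.embDomain_apply_self, this]
    · rw [restr_apply, Finsupp.embDomain_of_notMem_range _ _ _ hi,
        Finsupp.embDomain_of_notMem_range _ _ _ hi, ite_self]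
  rw [hlin, hlin, hres]
  refine le_trans (le_of_eq ?_) (hz (v.embDomain f) (φ p.1) (φ p.2))
  have hsub : (restr (Finset.Ico (φ p.1) (φ p.2)) (v.embDomain f)).support ⊆
      Finset.Ico (φ p.1) (φ p.2) := by
    intro i hi
    rw [restr_support, Finset.mem_filter] at hi
    exact hi.2
  rw [lin_eq_sum z _ hsub]
  congr 1
  exact Finset.sum_congr rfl fun i hi => by rw [restr_apply, if_pos hi]

/-! ### Almost monotone block bases -/

/-- Compactness of the unit sphere of V: finitely many Hahn–Banach functionals almost norm every
vector. -/
theorem exists_norming_finset (V : Submodule ℝ X) [FiniteDimensional ℝ V] {η : ℝ} (hη : 0 < η) :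
    ∃ Φ : Finset (StrongDual ℝ X), (∀ f ∈ Φ, ‖f‖ ≤ 1) ∧
      ∀ u ∈ V, u ≠ 0 → ∃ f ∈ Φ, ‖u‖ ≤ (1 + η) * ‖f u‖ := by
  classical
  choose F hF1 hF2 using fun u : X => exists_dual_vector'' ℝ u
  have hcomp : IsCompact ((↑) '' Metric.sphere (0 : V) 1 : Set X) :=
    (isCompact_sphere (0 : V) 1).image continuous_subtype_val
  obtain ⟨T, hT, hcover⟩ := hcomp.elim_nhds_subcover (fun u => {w | 1 / (1 + η) < F u w}) (by
    rintro _ ⟨u, hu, rfl⟩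
    refine (isOpen_lt continuous_const (F u).continuous).mem_nhds ?_
    have h1 : ‖(u : X)‖ = 1 := by simpa using hu
    change 1 / (1 + η) < F u u
    have h2 : F u u = 1 := by rw [hF2, h1]; rfl
    rw [h2, div_lt_one (by linarith)]
    linarith)
  refine ⟨T.image F, fun f hf => ?_, fun u hu hu0 => ?_⟩
  · obtain ⟨w, -, rfl⟩ := Finset.mem_image.1 hf
    exact hF1 w
  · have hn : 0 < ‖u‖ := norm_pos_iff.2 hu0
    have hmem : ‖u‖⁻¹ • u ∈ ((↑) '' Metric.sphere (0 : V) 1 : Set X) := by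
      refine ⟨⟨‖u‖⁻¹ • u, V.smul_mem _ hu⟩, ?_, rfl⟩
      rw [mem_sphere_zero_iff_norm, Submodule.coe_norm, norm_smul, norm_inv, norm_norm,
        inv_mul_cancel₀ hn.ne']
    obtain ⟨w, hw, hlt⟩ := Set.mem_iUnion₂.1 (hcover hmem)
    refine ⟨F w, Finset.mem_image_of_mem _ hw, ?_⟩
    have hlt : 1 / (1 + η) < F w (‖u‖⁻¹ • u) := hlt
    rw [map_smul, smul_eq_mul, div_lt_iff₀ (by linarith), inv_mul_eq_div, div_mul_eq_mul_div,
      lt_div_iff₀ hn, one_mul] at hlt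
    have := Real.le_norm_self (F w u)
    nlinarith

theorem exists_normalized_vector {z : ℕ → X} (hz : ∀ d : ℕ →₀ ℝ, d ≠ 0 → lin z d ≠ 0)
    (Φ : Finset (StrongDual ℝ X)) (b : ℕ) :
    ∃ d : ℕ →₀ ℝ, (∀ k ∈ d.support, b ≤ k) ∧ ‖lin z d‖ = 1 ∧ ∀ f ∈ Φ, f (lin z d) = 0 := by
  let ι : Fin (Φ.card + 1) ↪ ℕ := ⟨fun i => b + i, fun i j hij => Fin.ext (Nat.add_left_cancel hij)⟩
  let T : (Fin (Φ.card + 1) →₀ ℝ) →ₗ[ℝ] (Φ → ℝ) := LinearMap.pi fun f =>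
    (f : StrongDual ℝ X).toLinearMap ∘ₗ Finsupp.linearCombination ℝ (z ∘ ι)
  have hT : LinearMap.ker T ≠ ⊥ := LinearMap.ker_ne_bot_of_finrank_lt (by simp)
  obtain ⟨c, hc, hc0⟩ := Submodule.exists_mem_ne_zero_of_ne_bot hT
  set d := c.embDomain ι with hd
  have hd0 : d ≠ 0 := by rwa [hd, Ne, Finsupp.embDomain_eq_zero]
  have hn : ‖lin z d‖ ≠ 0 := norm_ne_zero_iff.2 (hz d hd0)
  have hdb : ∀ k ∈ d.support, b ≤ k := by
    intro k hk
    rw [hd, Finsupp.support_embDomain, Finset.mem_map] at hk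
    obtain ⟨i, -, rfl⟩ := hk
    exact Nat.le_add_right _ _
  refine ⟨‖lin z d‖⁻¹ • d, fun k hk => hdb k (Finsupp.support_smul hk), ?_, fun f hf => ?_⟩
  · rw [lin_smul, norm_smul, norm_inv, norm_norm, inv_mul_cancel₀ hn]
  · have h1 : T c ⟨f, hf⟩ = 0 := by rw [LinearMap.mem_ker.1 hc]; rfl
    have h2 : f (lin z d) = 0 := by
      rw [lin_eq, hd, Finsupp.linearCombination_embDomain]
      exact h1
    rw [lin_smul, map_smul, h2, smul_zero]

/-- Mazur's construction of a block basis with basis constant close to one. -/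
theorem exists_almost_monotone {z : ℕ → X} (hz : ∀ d : ℕ →₀ ℝ, d ≠ 0 → lin z d ≠ 0)
    {ψ : ℕ → ℕ} (hψ : Monotone ψ) {η : ℝ} (hη : 0 < η) :
    ∃ d : ℕ → ℕ →₀ ℝ, IsBlockCoeffs d ∧ (∀ n, ∀ k ∈ (d n).support, ψ n ≤ k) ∧
      (∀ n, ‖lin z (d n)‖ = 1) ∧ ∀ (v : ℕ →₀ ℝ) (n : ℕ),
        ‖lin (fun i => lin z (d i)) (restr (Finset.Ico 0 n) v)‖ ≤
          (1 + η) * ‖lin (fun i => lin z (d i)) v‖ := by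
  classical
  -- A state records the new block, a space containing all blocks so far, functionals almost norming
  -- that space, and a counter. The counter grows strictly, hence is at least n at stage n, which
  -- gives the support condition for ψ.
  obtain ⟨f, hP, hr⟩ := exists_seq_of_forall_finset_exists
    (α := (ℕ →₀ ℝ) × Submodule ℝ X × Finset (StrongDual ℝ X) × ℕ)
    (fun s => ‖lin z s.1‖ = 1 ∧ lin z s.1 ∈ s.2.1 ∧ FiniteDimensional ℝ s.2.1 ∧
      (∀ f ∈ s.2.2.1, ‖f‖ ≤ 1) ∧
      (∀ u ∈ s.2.1, u ≠ 0 → ∃ f ∈ s.2.2.1, ‖u‖ ≤ (1 + η) * ‖f u‖) ∧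
      ∀ k ∈ s.1.support, ψ s.2.2.2 ≤ k)
    (fun s t => s.2.2.2 < t.2.2.2 ∧ s.2.1 ≤ t.2.1 ∧ Before s.1.support t.1.support ∧
      ∀ f ∈ s.2.2.1, f (lin z t.1) = 0) (by
    intro S hS
    set n := S.sup (fun s => s.2.2.2) + 1
    set b := S.sup fun s => s.1.support.sup Nat.succ
    obtain ⟨d, hd1, hd2, hd3⟩ := exists_normalized_vector hz (S.biUnion fun s => s.2.2.1)
      (max b (ψ n))
    have : FiniteDimensional ℝ (S.sup fun s => s.2.1 : Submodule ℝ X) := by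
      rw [Finset.sup_eq_iSup]
      have : ∀ s : {s // s ∈ S}, FiniteDimensional ℝ s.1.2.1 := fun s => (hS s.1 s.2).2.2.1
      rw [iSup_subtype']
      infer_instance
    obtain ⟨Φ, hΦ1, hΦ2⟩ := exists_norming_finset
      ((S.sup fun s => s.2.1) ⊔ Submodule.span ℝ {lin z d}) hη
    refine ⟨(d, (S.sup fun s => s.2.1) ⊔ Submodule.span ℝ {lin z d}, Φ, n),
      ⟨hd2, le_sup_right (a := S.sup fun s => s.2.1) (Submodule.mem_span_singleton_self _),
        inferInstance, hΦ1, hΦ2, fun k hk => (le_max_right _ _).trans (hd1 k hk)⟩,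
      fun s hs => ⟨?_, ?_, ?_, ?_⟩⟩
    · exact Nat.lt_succ_of_le (Finset.le_sup (f := fun s => s.2.2.2) hs)
    · exact (Finset.le_sup (f := fun s => s.2.1) hs).trans le_sup_left
    · intro i hi j hj
      have h1 : i.succ ≤ s.1.support.sup Nat.succ := Finset.le_sup hi
      have h2 : s.1.support.sup Nat.succ ≤ b :=
        Finset.le_sup (f := fun s => s.1.support.sup Nat.succ) hs
      have := hd1 j hj
      omega
    · exact fun f hf => hd3 f (Finset.mem_biUnion.2 ⟨s, hs, hf⟩))
  set d : ℕ → ℕ →₀ ℝ := fun n => (f n).1 with hd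
  have hmono : StrictMono fun n => (f n).2.2.2 := fun m n h => (hr m n h).1
  have hV : Monotone fun n => (f n).2.1 :=
    monotone_nat_of_le_succ fun n => (hr n (n + 1) n.lt_succ_self).2.1
  refine ⟨d, ⟨fun n h0 => ?_, fun m n h => (hr m n h).2.2.1⟩,
    fun n k hk => (hψ (hmono.id_le n)).trans ((hP n).2.2.2.2.2 k hk), fun n => (hP n).1, ?_⟩
  · have h1 := (hP n).1
    have h0 : (f n).1 = 0 := h0
    rw [h0, lin_zero, norm_zero] at h1
    exact zero_ne_one h1
  · intro v n
    set x : ℕ → X := fun i => lin z (d i) with hx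
    set p := restr (Finset.Ico 0 n) v with hp
    have hpsub : p.support ⊆ Finset.Ico 0 n := by
      intro i hi
      rw [hp, restr_support, Finset.mem_filter] at hi
      exact hi.2
    by_cases h0 : lin x p = 0
    · rw [h0, norm_zero]
      positivity
    obtain _ | n := n
    · refine absurd ?_ h0
      rw [lin_eq_sum x p hpsub]
      simp
    have hmem : lin x p ∈ (f n).2.1 := by
      rw [lin_eq_sum x p hpsub]
      refine Submodule.sum_mem _ fun i hi => Submodule.smul_mem _ _ ?_
      exact hV (Nat.lt_succ_iff.1 (Finset.mem_Ico.1 hi).2) (hP i).2.1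
    obtain ⟨h, hh, hle⟩ := (hP n).2.2.2.2.1 _ hmem h0
    -- Later blocks lie in the kernels of the earlier norming functionals, so h does not see the
    -- part of v beyond p.
    have heq : h (lin x p) = h (lin x v) := by
      have e1 : lin x v = lin x p + lin x (v - p) := by rw [← lin_add, add_sub_cancel]
      have e2 : h (lin x (v - p)) = 0 := by
        rw [lin, Finsupp.sum, map_sum]
        refine Finset.sum_eq_zero fun i hi => ?_
        rw [map_smul]
        have hin : n < i := by
          by_contra hlt
          refine Finsupp.mem_support_iff.1 hi ?_
          rw [Finsupp.sub_apply, hp, restr_apply, if_pos (Finset.mem_Ico.2 ⟨Nat.zero_le _, by omega⟩),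
            sub_self]
        rw [(hr n i hin).2.2.2 h hh, smul_zero]
      rw [e1, map_add, e2, add_zero]
    refine hle.trans ?_
    rw [heq]
    gcongr
    exact (h.le_opNorm _).trans (mul_le_of_le_one_left (norm_nonneg _) ((hP n).2.2.2.1 h hh))

/-- An interval projection is the difference of two initial projections, whence the factor 2. -/
theorem intervalNorm_le_of_initial {x : ℕ → X} {C : ℝ}
    (h : ∀ (v : ℕ →₀ ℝ) (n : ℕ), ‖lin x (restr (Finset.Ico 0 n) v)‖ ≤ C * ‖lin x v‖)
    (v : ℕ →₀ ℝ) : intervalNorm x v ≤ 2 * C * ‖lin x v‖ := by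
  refine ciSup_le fun ⟨s, t⟩ => ?_
  have e1 : restr (Finset.Ico 0 (max s t)) v =
      restr (Finset.Ico 0 s) v + restr (Finset.Ico s t) v := by
    ext i
    simp only [Finsupp.add_apply, restr_apply, Finset.mem_Ico]
    split_ifs <;> first | omega | simp
  have e2 := congrArg (lin x) e1
  rw [lin_add] at e2
  have e3 : lin x (restr (Finset.Ico s t) v) =
      lin x (restr (Finset.Ico 0 (max s t)) v) - lin x (restr (Finset.Ico 0 s) v) := by
    rw [e2, add_sub_cancel_left]
  dsimp only
  rw [e3]
  refine (norm_sub_le _ _).trans ?_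
  linarith [h v (max s t), h v s]

/-! ### Block bases of linearly independent sequences -/

/-- The blocks have disjoint supports, so a coordinate in the support of one block sees only that
block's coefficient. -/
theorem IsBlockBasis.lin_ne_zero {u z : ℕ → X} (hu : LinearIndependent ℝ u)
    (hz : IsBlockBasis u z) (d : ℕ →₀ ℝ) (hd : d ≠ 0) : lin z d ≠ 0 := by
  obtain ⟨c, ⟨hc0, hc⟩, hzc⟩ := hz
  obtain ⟨j, hj⟩ := Finsupp.support_nonempty_iff.2 hd
  obtain ⟨k, hk⟩ := Finsupp.support_nonempty_iff.2 (hc0 j)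
  have e1 : lin z d = lin u (∑ i ∈ d.support, d i • c i) := by
    rw [lin_sum, lin, Finsupp.sum]
    exact Finset.sum_congr rfl fun i _ => by rw [lin_smul, hzc]
  intro h0
  rw [e1, lin_eq] at h0
  have h1 := DFunLike.congr_fun (linearIndependent_iff.1 hu _ h0) k
  rw [Finsupp.finsetSum_apply, Finset.sum_eq_single_of_mem j hj] at h1
  · exact mul_ne_zero (Finsupp.mem_support_iff.1 hj) (Finsupp.mem_support_iff.1 hk) h1
  · intro i _ hij
    have : k ∉ (c i).support := fun hki => by
      rcases lt_or_gt_of_ne hij with h | h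
      · exact lt_irrefl _ (hc i j h k hki k hk)
      · exact lt_irrefl _ (hc j i h k hk k hki)
    rw [Finsupp.smul_apply, Finsupp.notMem_support_iff.1 this, smul_zero]

end AsymptoticEllOne

end

/-! ### The two lower estimates -/

theorem proposition5p5 {X : Type*} [NormedAddCommGroup X] [NormedSpace ℝ X] [CompleteSpace X]
    (e : SchauderBasis ℝ X) (hX : AsymptoticEllOne.IsAsymptoticEllOne e)
    (L : Ordinal.{0} → ℕ → Ordinal.{0}) (hL : AsymptoticEllOne.IsLadder L)
    (z : ℕ → X) (hz : AsymptoticEllOne.IsBlockBasis e.basis z)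
    (γ : Ordinal.{0} → ℝ) (hγ : AsymptoticEllOne.DeltaStabilizes L z γ)
    (hγ1 : γ 1 ∈ Set.Ioo (0 : ℝ) 1) :
    ((∀ i, ‖z i‖ = 1) → AsymptoticEllOne.IsBimonotone z →
      ∀ ε : ℝ, 0 < ε → ∃ φ : ℕ → ℕ, StrictMono φ ∧
        AsymptoticEllOne.LowerEstimate ⟨γ 1, hγ1⟩ (1 - ε) (z ∘ φ)) ∧
    (∀ ε : ℝ, 0 < ε → ∃ x : ℕ → X, AsymptoticEllOne.IsBlockBasis z x ∧ (∀ i, ‖x i‖ = 1) ∧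
      AsymptoticEllOne.LowerEstimate ⟨γ 1, hγ1⟩ (1 / 2 * (1 - ε)) x ∧
      AsymptoticEllOne.LowerBlockEstimate ⟨γ 1, hγ1⟩ (1 / 2 * (1 - ε)) x) := by
  open AsymptoticEllOne in
  constructor
  · intro hz1 hbi ε hε
    -- The minimum keeps the parameter below 1 when ε is large.
    have hε'0 : 0 < min ε (1 / 2) := lt_min hε (by norm_num)
    have hε'1 : min ε (1 / 2) < 1 := (min_le_right _ _).trans_lt (by norm_num)
    obtain ⟨ψ, hψ, h⟩ := exists_sparse hγ hγ1 hε'0 hε'1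
    -- ψ is only monotone; adding n makes the indices strictly increasing.
    have hφ : StrictMono fun n => ψ n + n := hψ.add_strictMono strictMono_id
    have hsupp : ∀ n, ((Finsupp.single (ψ n + n) (1 : ℝ)).support : Finset ℕ) = {ψ n + n} :=
      fun n => Finsupp.support_single _ one_ne_zero
    have key := h (fun n => Finsupp.single (ψ n + n) 1) ⟨fun n => by simp, fun i j hij k hk l hl => by
        rw [Finset.mem_singleton.1 ((hsupp i).subset hk), Finset.mem_singleton.1 ((hsupp j).subset hl)]
        exact hφ hij⟩
      (fun n k hk => by
        rw [hsupp, Finset.mem_singleton] at hk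
        omega) 1 one_pos
    simp only [lin_single, one_smul, one_mul, div_one] at key
    refine ⟨fun n => ψ n + n, hφ, SuccessiveLowerEstimate.lowerEstimate
      (key fun v => hbi.intervalNorm_comp_le hφ v) (fun i => hz1 _) (by linarith) ?_⟩
    linarith [min_le_left ε (1 / 2)]
  · intro ε hε
    -- One κ is spent in the Tsirelson estimate and one on the basis constant: (1 - κ)/(1 + κ) ≥ 1 -
    -- 2κ ≥ 1 - ε.
    set κ := min ε (1 / 2) / 2 with hκ
    have hκ0 : 0 < κ := half_pos (lt_min hε (by norm_num))
    have hκ1 : κ < 1 := by linarith [min_le_right ε (1 / 2)]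
    have hκε : 2 * κ ≤ ε := by linarith [min_le_left ε (1 / 2)]
    obtain ⟨ψ, hψ, h⟩ := exists_sparse hγ hγ1 hκ0 hκ1
    obtain ⟨d, hd, hdψ, hd1, hinit⟩ := exists_almost_monotone
      (hz.lin_ne_zero e.linearIndependent) hψ hκ0
    have key := h d hd hdψ (2 * (1 + κ)) (by linarith) fun v => intervalNorm_le_of_initial hinit v
    have hpos : 0 < (1 - κ) / (2 * (1 + κ)) := div_pos (by linarith) (by linarith)
    have hle : 1 / 2 * (1 - ε) ≤ (1 - κ) / (2 * (1 + κ)) := by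
      rw [le_div_iff₀ (by linarith)]
      nlinarith
    exact ⟨fun i => lin z (d i), ⟨d, hd, fun i => rfl⟩, hd1,
      SuccessiveLowerEstimate.lowerEstimate key hd1 hpos hle,
      SuccessiveLowerEstimate.lowerBlockEstimate key hle⟩
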